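/- Let $U$ be a finite set. An implicational base $\Sigma$ over $U$ is a finite set of implications $A\to b$ with $\emptyset\ne A\subseteq U$ and $b\in U$; for $X\subseteq U$ put $\Sigma[X]=\{A\to b\in\Sigma : A\cup\{b\}\subseteq X\}$. A premise-path in $\Sigma$ is a sequence of elements of $U$ in which any two consecutive elements lie in the premise $A$ of a common implication $A\to b\in\Sigma$. A premise-connected component of $\Sigma$ is an inclusion-wise maximal subset of $U$ any two elements of which are joined by a premise-path. A $\Sigma$-tree is a full rooted binary tree with a labelling of its nodes such that: each leaf is labelled by an element of $U$; each interior node is labelled by a (possibly empty) subset of $\Sigma$; every element of $U$ labels exactly one leaf and every implication of $\Sigma$ lies in the label of exactly one interior node; and if $A\to b$ is in the label of a node $t$, then all elements of $A$ label leaves below one child of $t$ and $b$ labels a leaf below the other child. For $U=\emptyset$ (hence $\Sigma=\emptyset$) the empty tree is a $\Sigma$-tree. $\Sigma$ is H-decomposable if it has a $\Sigma$-tree. The algorithm BuildTree works as follows on input $(U,\Sigma)$. If $U=\emptyset$, return the empty tree; if $U=\{v\}$, return a leaf labelled $v$. Otherwise compute some premise-connected component $C$ of $\Sigma$. If $|C|=|U|$,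 stop the whole run and return FAIL. If not, return a node labelled $\Sigma\setminus(\Sigma[C]\cup\Sigma[U\setminus C])$ whose left and right subtrees are obtained by running BuildTree on $(C,\Sigma[C])$ and on $(U\setminus C,\Sigma[U\setminus C])$. Let $\alpha(m,n)=\min\{i\ge 1 : \mathrm{Ack}(i,\lfloor m/n\rfloor)>\log_2 n\}$ be the inverse Ackermann function. **Theorem.** 1. Let $\Sigma$ be an implicational base over $U$ that contains no implication of the form $\{a\}\to a$. Then BuildTree has an outcome on $(U,\Sigma)$, and, whatever components are chosen, every outcome is a $\Sigma$-tree if $\Sigma$ is H-decomposable, and FAIL if it is not. 2. BuildTree can be implemented on a word RAM so that on every implicational base $\Sigma$ over $U=\{0,\dots,n-1\}$ (input: $n$, $|\Sigma|$, and for each implication $A\to b$ the number $b$ and the characteristic vector of $A$) it runs in $O(|U|^2\cdot|\Sigma|\cdot\alpha(|\Sigma||U|,|U|))$ time and $O(|\Sigma||U|)$ space, counted in memory words of $O(1+\log(|\Sigma||U|))$ bits and including the input and the output. That is, one fixed program halts within these bounds and writes an encoding of a possible outcome of BuildTree on $(U,\Sigma)$. In the bounds, $|U|$ and $|\Sigma|$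 are to be read as $1$ when they are $0$. -/

import Mathlib

/-! ## Implicational bases, premise-connectivity and trees -/

namespace HDecomp

/-- An implication `A → b` (unit form): the premise is the set `A`, the conclusion is the
element `b`. -/
abbrev Implication (V : Type*) := Finset V × V

/-- `S` is a set of implications `A → b` with `A ∪ {b} ⊆ U` and nonempty premises `A`. -/
def IsBase {V : Type*} (U : Finset V) (S : Finset (Implication V)) : Prop :=
  ∀ p ∈ S, p.1 ⊆ U ∧ p.2 ∈ U ∧ p.1.Nonempty

/-- The sub-base `S[X]`, consisting of the implications `A → b` of `S` with `A ∪ {b} ⊆ X`. -/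
def restrict {V : Type*} [DecidableEq V] (S : Finset (Implication V)) (X : Finset V) :
    Finset (Implication V) :=
  S.filter fun p => p.1 ⊆ X ∧ p.2 ∈ X

/-- One step of a premise-path: both elements lie in the premise of one implication. -/
def PremiseAdj {V : Type*} (S : Finset (Implication V)) (u v : V) : Prop :=
  ∃ p ∈ S, u ∈ p.1 ∧ v ∈ p.1

/-- There is a premise-path from `u` to `v`. -/
def PremiseConnected {V : Type*} (S : Finset (Implication V)) (u v : V) : Prop :=
  Relation.ReflTransGen (PremiseAdj S) u v

/-- `C` is a premise-connected component of the base `S` over `U`: an inclusion-wise maximal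
subset of `U` whose elements are pairwise joined by premise-paths. -/
def IsPremiseComponent {V : Type*} (U : Finset V) (S : Finset (Implication V))
    (C : Finset V) : Prop :=
  Maximal (fun C : Finset V => C ⊆ U ∧ ∀ u ∈ C, ∀ v ∈ C, PremiseConnected S u v) C

/-- Nonempty full rooted binary trees: leaves are labelled by elements of the ground set,
interior nodes by sets of implications. -/
inductive LTree (V : Type*) where
  | leaf (v : V) : LTree V
  | node (label : Finset (Implication V)) (left right : LTree V) : LTree V

/-- The labels of the leaves, from left to right, with repetitions. -/
def LTree.leaves {V : Type*} : LTree V → List V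
  | .leaf v => [v]
  | .node _ l r => l.leaves ++ r.leaves

/-- The labels of the interior nodes, with repetitions. -/
def LTree.labels {V : Type*} : LTree V → List (Finset (Implication V))
  | .leaf _ => []
  | .node L l r => L :: (l.labels ++ r.labels)

/-- For every interior node and every implication `A → b` in its label, all elements of `A` label
leaves below one child, and `b` labels a leaf below the other child. -/
def LTree.Separates {V : Type*} : LTree V → Prop
  | .leaf _ => True
  | .node L l r =>
      (∀ p ∈ L, ((∀ a ∈ p.1, a ∈ l.leaves) ∧ p.2 ∈ r.leaves) ∨
        ((∀ a ∈ p.1, a ∈ r.leaves) ∧ p.2 ∈ l.leaves)) ∧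
      l.Separates ∧ r.Separates

/-- `T` is a tree of the base `S` over `U`; `none` is the empty tree. For a nonempty tree the
labels of its nodes form a partition (with possibly empty blocks) of `U ∪ S`. -/
def IsSigmaTree {V : Type*} (U : Finset V) (S : Finset (Implication V)) :
    Option (LTree V) → Prop
  | none => U = ∅ ∧ S = ∅
  | some t =>
      (t.leaves.Nodup ∧ ∀ v, v ∈ t.leaves ↔ v ∈ U) ∧
      (∀ L ∈ t.labels, L ⊆ S) ∧
      t.Separates ∧
      (t.labels.Pairwise Disjoint ∧ ∀ p ∈ S, ∃ L ∈ t.labels, p ∈ L)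

/-- `S` is hierarchically decomposable. -/
def HDecomposable {V : Type*} (U : Finset V) (S : Finset (Implication V)) : Prop :=
  ∃ T, IsSigmaTree U S T

/-! ## The algorithm -/

/-- What the algorithm returns: `FAIL`, or a possibly empty tree. -/
inductive Outcome (V : Type*) where
  | fail : Outcome V
  | ok (T : Option (LTree V)) : Outcome V

/-- `BuildTree U S o`: the algorithm, run on the base `S` over `U`, can return `o`. The only
freedom is which premise-connected component `C` is computed in each call. A call that
reaches `FAIL` stops the whole run. -/
inductive BuildTree {V : Type*} [DecidableEq V] :
    Finset V → Finset (Implication V) → Outcome V → Prop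
  | empty (S : Finset (Implication V)) : BuildTree ∅ S (.ok none)
  | single (v : V) (S : Finset (Implication V)) : BuildTree {v} S (.ok (some (.leaf v)))
  | halt (U : Finset V) (S : Finset (Implication V)) (C : Finset V) (hU : 2 ≤ U.card)
      (hC : IsPremiseComponent U S C) (hcard : C.card = U.card) : BuildTree U S .fail
  | failLeft (U : Finset V) (S : Finset (Implication V)) (C : Finset V) (hU : 2 ≤ U.card)
      (hC : IsPremiseComponent U S C) (hcard : C.card ≠ U.card)
      (hl : BuildTree C (restrict S C) .fail) : BuildTree U S .fail
  | failRight (U : Finset V) (S : Finset (Implication V)) (C : Finset V) (l : LTree V)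
      (hU : 2 ≤ U.card) (hC : IsPremiseComponent U S C) (hcard : C.card ≠ U.card)
      (hl : BuildTree C (restrict S C) (.ok (some l)))
      (hr : BuildTree (U \ C) (restrict S (U \ C)) .fail) : BuildTree U S .fail
  | node (U : Finset V) (S : Finset (Implication V)) (C : Finset V) (l r : LTree V)
      (hU : 2 ≤ U.card) (hC : IsPremiseComponent U S C) (hcard : C.card ≠ U.card)
      (hl : BuildTree C (restrict S C) (.ok (some l)))
      (hr : BuildTree (U \ C) (restrict S (U \ C)) (.ok (some r))) :
      BuildTree U S (.ok (some (.node (S \ (restrict S C ∪ restrict S (U \ C))) l r)))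

/-! ## The machine model: a word RAM with structured programs -/

/-- Binary operations of the machine; comparisons return `0` or `1`, subtraction is truncated. -/
inductive BinOp where
  | add | sub | mul | lt | eq

def BinOp.eval : BinOp → ℕ → ℕ → ℕ
  | .add, x, y => x + y
  | .sub, x, y => x - y
  | .mul, x, y => x * y
  | .lt, x, y => if x < y then 1 else 0
  | .eq, x, y => if x = y then 1 else 0

/-- Programs. Registers are indexed by `ℕ`, but a program mentions only finitely many. -/
inductive Prog where
  /-- do nothing -/
  | skip : Prog
  /-- `R d := k` -/
  | const (d k : ℕ) : Prog
  /-- `R d := R a o R b` -/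
  | op (o : BinOp) (d a b : ℕ) : Prog
  /-- `R d := M[R a]` -/
  | load (d a : ℕ) : Prog
  /-- `M[R a] := R b` -/
  | store (a b : ℕ) : Prog
  /-- run one program after the other -/
  | seq (P Q : Prog) : Prog
  /-- if `R r ≠ 0` then `P` else `Q` -/
  | cond (r : ℕ) (P Q : Prog) : Prog
  /-- while `R r ≠ 0` do `P` -/
  | loop (r : ℕ) (P : Prog) : Prog

/-- The contents of the registers and of the memory cells. -/
structure State where
  reg : ℕ → ℕ
  mem : ℕ → ℕ

def State.setReg (s : State) (d x : ℕ) : State := { s with reg := Function.update s.reg d x }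

def State.setMem (s : State) (a x : ℕ) : State := { s with mem := Function.update s.mem a x }

/-- `Exec space word P s s' t`: on a machine whose memory consists of the cells with addresses
`< space` and whose words hold the numbers `< word`, the program `P` started in the state `s`
halts in the state `s'` after exactly `t` steps. Every instruction and every test is
one step. There is no execution that accesses another cell or computes a larger number. -/
inductive Exec (space word : ℕ) : Prog → State → State → ℕ → Prop
  | skip (s : State) : Exec space word .skip s s 1
  | const (s : State) (d k : ℕ) (hk : k < word) :
      Exec space word (.const d k) s (s.setReg d k) 1
  | op (s : State) (o : BinOp) (d a b : ℕ) (hw : o.eval (s.reg a) (s.reg b) < word) :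
      Exec space word (.op o d a b) s (s.setReg d (o.eval (s.reg a) (s.reg b))) 1
  | load (s : State) (d a : ℕ) (ha : s.reg a < space) :
      Exec space word (.load d a) s (s.setReg d (s.mem (s.reg a))) 1
  | store (s : State) (a b : ℕ) (ha : s.reg a < space) :
      Exec space word (.store a b) s (s.setMem (s.reg a) (s.reg b)) 1
  | seq {P Q : Prog} {s₁ s₂ s₃ : State} {t₁ t₂ : ℕ} (h₁ : Exec space word P s₁ s₂ t₁)
      (h₂ : Exec space word Q s₂ s₃ t₂) : Exec space word (.seq P Q) s₁ s₃ (t₁ + t₂)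
  | condTrue {r : ℕ} {P Q : Prog} {s s' : State} {t : ℕ} (hr : s.reg r ≠ 0)
      (h : Exec space word P s s' t) : Exec space word (.cond r P Q) s s' (t + 1)
  | condFalse {r : ℕ} {P Q : Prog} {s s' : State} {t : ℕ} (hr : s.reg r = 0)
      (h : Exec space word Q s s' t) : Exec space word (.cond r P Q) s s' (t + 1)
  | loopDone {r : ℕ} {P : Prog} {s : State} (hr : s.reg r = 0) :
      Exec space word (.loop r P) s s 1
  | loopStep {r : ℕ} {P : Prog} {s₁ s₂ s₃ : State} {t₁ t₂ : ℕ} (hr : s₁.reg r ≠ 0)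
      (h₁ : Exec space word P s₁ s₂ t₁) (h₂ : Exec space word (.loop r P) s₂ s₃ t₂) :
      Exec space word (.loop r P) s₁ s₃ (t₁ + t₂ + 1)

/-- The initial state: the input occupies the first memory cells, everything else is `0`. -/
def State.init (input : List ℕ) : State where
  reg := fun _ => 0
  mem := fun i => input.getD i 0

/-- The output of a halted machine: register `0` holds its address, register `1` its length. -/
def State.output (s : State) : List ℕ :=
  (List.range (s.reg 1)).map fun i => s.mem (s.reg 0 + i)

/-! ## Encodings of inputs and outputs -/

/-- The input word for the base listed by `B` over the ground set `{0, …, n - 1}`: the number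
`n`, the number of implications, and for each implication `A → b` the number `b` followed by the
characteristic vector of `A`. -/
def encodeBase {n : ℕ} (B : List (Implication (Fin n))) : List ℕ :=
  n :: B.length :: B.flatMap fun p =>
    (p.2 : ℕ) :: List.ofFn fun v : Fin n => if v ∈ p.1 then 1 else 0

/-- `EncodesTree B t w`: the word `w` lists the tree `t` in preorder. A leaf is written as `0`
followed by its label; an interior node as `1`, the number of implications in its label, the
positions of these implications in the list `B` (in any order), and then its two subtrees. -/
inductive EncodesTree {n : ℕ} (B : List (Implication (Fin n))) : LTree (Fin n) → List ℕ → Prop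
  | leaf (v : Fin n) : EncodesTree B (.leaf v) [0, (v : ℕ)]
  | node (idx : List (Fin B.length)) (hidx : idx.Nodup) {l r : LTree (Fin n)} {wl wr : List ℕ}
      (hl : EncodesTree B l wl) (hr : EncodesTree B r wr) :
      EncodesTree B (.node (idx.map B.get).toFinset l r)
        (1 :: idx.length :: (idx.map (fun i => (i : ℕ)) ++ wl ++ wr))

/-- `FAIL` is written as `0`, the empty tree as `1`, a nonempty tree as `2` and its word. -/
inductive EncodesOutcome {n : ℕ} (B : List (Implication (Fin n))) :
    Outcome (Fin n) → List ℕ → Prop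
  | fail : EncodesOutcome B .fail [0]
  | empty : EncodesOutcome B (.ok none) [1]
  | tree {t : LTree (Fin n)} {w : List ℕ} (h : EncodesTree B t w) :
      EncodesOutcome B (.ok (some t)) (2 :: w)

/-- The two-parameter inverse Ackermann function
`α(m, n) = min {i ≥ 1 | ack (i, ⌊m / n⌋) > log₂ n}`. (For a natural number `k`, the inequality
`log₂ n < k` is the same as `⌊log₂ n⌋ < k`.) -/
noncomputable def invAckermann (m n : ℕ) : ℕ :=
  sInf {i | 1 ≤ i ∧ Nat.log 2 n < ack i (m / n)}

end HDecomp

/-! Correctness rests on two facts about premise-connected components. First, a premise is pairwise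
connected, so it lies entirely inside a component `C` or entirely outside it
(`IsPremiseComponent.mem`). An implication inherited by neither part therefore has its premise on
one side and its conclusion on the other (`IsPremiseComponent.separates`), and a run that does not
fail builds a tree (`BuildTree.isSigmaTree`). The exclusion of `{a} → a` matters only at the leaves.

Second, a failing run exhibits a set `X` with at least two elements that is connected by the
implications inside `X` alone (`BuildTree.exists_connected`). In a tree, consider the lowest node
above all leaves labelled by `X`. Its two children split `X`, but every implication inside `X` has
its premise on one side: either it is separated at this node, or it is placed below one child. So
`X` would not be connected (`LTree.Separates.not_connected`), and no tree exists.

The implementation needs neither a recursion stack nor union-find. Each vertex carries a block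
number, and the pending blocks are numbered `0, …, k`; block `k` is processed next. A split gives
the number `k + 1` to the component and leaves `k` to the rest, so the calls occur in preorder and
the output is written from left to right; finished vertices get the number `n`. Components are found
by relabelling: each implication inside the block merges the classes that its premise meets
(`premiseConnected_insert`), in `O(n)` steps. With `m` and `n` read as at least `1`, one call costs
`O(mn)`, a tree with `n` leaves has `2n - 1` nodes, and the total is `O(n²m)`; the factor `α ≥ 1`
only weakens this bound. The output has `O(mn)` words even if every label is counted with `m`
entries. Programs are verified by timed triples `Tr` over five arrays; `Tr.processBlock` treats one
call and `exec_block` the whole loop. -/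

namespace HDecomp

/-! ### Premise-connected components and the correctness of the algorithm -/

section Combinatorics

variable {V : Type*} {U X C : Finset V} {S : Finset (Implication V)}

theorem premiseConnected_symm {u v : V} (h : PremiseConnected S u v) :
    PremiseConnected S v u := by
  induction h with
  | refl => exact .refl
  | tail _ h ih =>
    obtain ⟨p, hp, hx, hy⟩ := h
    exact .head ⟨p, hp, hy, hx⟩ ih

theorem premiseConnected_mono {S' : Finset (Implication V)} (hS : S ⊆ S') {u v : V}
    (h : PremiseConnected S u v) : PremiseConnected S' u v :=
  Relation.ReflTransGen.mono (fun _ _ ⟨p, hp, hx, hy⟩ => ⟨p, hS hp, hx, hy⟩) _ _ h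

theorem premiseConnected_of_mem {p : Implication V} (hp : p ∈ S) {u v : V} (hu : u ∈ p.1)
    (hv : v ∈ p.1) : PremiseConnected S u v :=
  Relation.ReflTransGen.single ⟨p, hp, hu, hv⟩

/-- A set that no premise crosses is closed under premise-paths. -/
theorem mem_of_premiseConnected {P : V → Prop}
    (hP : ∀ p ∈ S, ∀ u ∈ p.1, ∀ v ∈ p.1, P u → P v) {u v : V}
    (h : PremiseConnected S u v) (hu : P u) : P v := by
  induction h with
  | refl => exact hu
  | tail _ h ih =>
    obtain ⟨p, hp, hx, hy⟩ := h
    exact hP p hp _ hx _ hy ih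

theorem IsPremiseComponent.subset (h : IsPremiseComponent U S C) : C ⊆ U := h.prop.1

/-- Inserting `v` keeps the set pairwise connected, with all paths passing through `u`, so
maximality forces `v` into it. -/
theorem IsPremiseComponent.mem [DecidableEq V] (h : IsPremiseComponent U S C) {u v : V}
    (hu : u ∈ C) (hv : v ∈ U) (huv : PremiseConnected S u v) : v ∈ C := by
  have key : insert v C ⊆ C := by
    refine h.le_of_ge ⟨Finset.insert_subset hv h.subset, ?_⟩ (Finset.subset_insert _ _)
    have hc : ∀ x ∈ insert v C, PremiseConnected S u x := by
      intro x hx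
      rcases Finset.mem_insert.1 hx with rfl | hx
      · exact huv
      · exact h.prop.2 _ hu _ hx
    intro x hx y hy
    exact (premiseConnected_symm (hc x hx)).trans (hc y hy)
  exact key (Finset.mem_insert_self _ _)

/-- Certifies the class computed by the machine: any larger pairwise connected subset of `U`
contains `v`, hence only elements reachable from `v`. -/
theorem isPremiseComponent_of_mem {v : V} (hv : v ∈ U)
    (hC : ∀ u, u ∈ C ↔ u ∈ U ∧ PremiseConnected S v u) : IsPremiseComponent U S C := by
  refine ⟨⟨fun u hu => ((hC u).1 hu).1, fun x hx y hy =>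
    (premiseConnected_symm ((hC x).1 hx).2).trans ((hC y).1 hy).2⟩, ?_⟩
  intro D hD hCD u hu
  exact (hC u).2 ⟨hD.1 hu, hD.2 _ (hCD ((hC v).2 ⟨hv, .refl⟩)) _ hu⟩

theorem exists_isPremiseComponent (hU : U.Nonempty) : ∃ C, IsPremiseComponent U S C := by
  classical
  obtain ⟨v, hv⟩ := hU
  exact ⟨U.filter (PremiseConnected S v), isPremiseComponent_of_mem hv (by simp)⟩

/-- The empty set is pairwise connected but not maximal, since any singleton of `U` is connected by
trivial paths. -/
theorem IsPremiseComponent.nonempty (h : IsPremiseComponent U S C) (hU : U.Nonempty) :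
    C.Nonempty := by
  rw [Finset.nonempty_iff_ne_empty]
  rintro rfl
  obtain ⟨v, hv⟩ := hU
  have := h.le_of_ge (y := {v}) ⟨by simpa using hv, by
    intro a ha b hb
    rw [Finset.mem_singleton.1 ha, Finset.mem_singleton.1 hb]
    exact .refl⟩ (Finset.empty_subset _)
  simp at this

theorem card_component_lt (hC : C ⊆ U) (h : C.card ≠ U.card) : C.card < U.card :=
  lt_of_le_of_ne (Finset.card_le_card hC) h

/-- Locates premises: an implication placed somewhere in one subtree cannot have premise elements
among the leaves of the other one. -/
theorem LTree.Separates.mem_leaves {t : LTree V} (h : t.Separates) {L : Finset (Implication V)}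
    (hL : L ∈ t.labels) {p : Implication V} (hp : p ∈ L) : ∀ a ∈ p.1, a ∈ t.leaves := by
  induction t with
  | leaf v => simp [LTree.labels] at hL
  | node M l r ihl ihr =>
    obtain ⟨h1, h2, h3⟩ := h
    simp only [LTree.labels, List.mem_cons, List.mem_append] at hL
    intro a ha
    simp only [LTree.leaves, List.mem_append]
    rcases hL with rfl | hL | hL
    · rcases h1 p hp with ⟨h, -⟩ | ⟨h, -⟩
      · exact .inl (h a ha)
      · exact .inr (h a ha)
    · exact .inl (ihl h2 hL a ha)
    · exact .inr (ihr h3 hL a ha)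

theorem premiseConnected_empty {u v : V} :
    PremiseConnected (∅ : Finset (Implication V)) u v ↔ u = v := by
  constructor
  · exact fun h => mem_of_premiseConnected (P := fun x => u = x) (by simp) h rfl
  · rintro rfl
    exact .refl

variable [DecidableEq V]

theorem mem_restrict {p : Implication V} : p ∈ restrict S X ↔ p ∈ S ∧ p.1 ⊆ X ∧ p.2 ∈ X := by
  simp [restrict]

theorem restrict_subset : restrict S X ⊆ S := Finset.filter_subset _ _

theorem IsBase.restrict (h : IsBase U S) (X : Finset V) : IsBase X (restrict S X) := by
  intro p hp
  obtain ⟨h1, h2, h3⟩ := mem_restrict.1 hp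
  exact ⟨h2, h3, (h p h1).2.2⟩

theorem IsBase.restrict_self (h : IsBase U S) : HDecomp.restrict S U = S := by
  ext p
  simp only [mem_restrict, and_iff_left_iff_imp]
  exact fun hp => ⟨(h p hp).1, (h p hp).2.1⟩

/-- Allows every nested call to be described by a restriction of the original base. -/
theorem restrict_restrict (h : X ⊆ C) : restrict (restrict S C) X = restrict S X := by
  ext p
  simp only [mem_restrict]
  exact ⟨fun ⟨⟨a, _⟩, b⟩ => ⟨a, b⟩, fun ⟨a, b, c⟩ => ⟨⟨a, b.trans h, h c⟩, b, c⟩⟩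

/-- Strong induction on the size of `U`. The case distinction on `o` is carried along because the
constructors of `BuildTree` require a nonempty tree from each successful subcall; both subcalls run
on nonempty sets. -/
theorem exists_buildTree (U : Finset V) (S : Finset (Implication V)) :
    ∃ o, BuildTree U S o ∧ (o = .fail ∨ (U = ∅ ∧ o = .ok none) ∨ ∃ t, o = .ok (some t)) := by
  induction hn : U.card using Nat.strong_induction_on generalizing U S with
  | _ n ih =>
    subst hn
    rcases Nat.lt_or_ge U.card 2 with h | h
    · rcases Nat.lt_or_ge U.card 1 with h0 | h1
      · obtain rfl : U = ∅ := by simpa using h0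
        exact ⟨_, .empty S, .inr (.inl ⟨rfl, rfl⟩)⟩
      · obtain ⟨v, rfl⟩ := Finset.card_eq_one.1 (by omega : U.card = 1)
        exact ⟨_, .single v S, .inr (.inr ⟨_, rfl⟩)⟩
    · have hne : U.Nonempty := Finset.card_pos.1 (by omega)
      obtain ⟨C, hC⟩ := exists_isPremiseComponent (S := S) hne
      by_cases hcard : C.card = U.card
      · exact ⟨_, .halt U S C h hC hcard, .inl rfl⟩
      · have hlt := card_component_lt hC.subset hcard
        have hCne := Finset.card_pos.2 (hC.nonempty hne)
        have hsd := Finset.card_sdiff_of_subset hC.subset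
        obtain ⟨o₁, h₁, rfl | ⟨h', -⟩ | ⟨l, rfl⟩⟩ := ih _ hlt C (restrict S C) rfl
        · exact ⟨_, .failLeft U S C h hC hcard h₁, .inl rfl⟩
        · simp [h'] at hCne
        · obtain ⟨o₂, h₂, rfl | ⟨h', -⟩ | ⟨r, rfl⟩⟩ :=
            ih _ (by omega) (U \ C) (restrict S (U \ C)) rfl
          · exact ⟨_, .failRight U S C l h hC hcard h₁ h₂, .inl rfl⟩
          · rw [h'] at hsd
            simp at hsd
            omega
          · exact ⟨_, .node U S C l r h hC hcard h₁ h₂, .inr (.inr ⟨_, rfl⟩)⟩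

/-- The reason for a failing run: a premise-connected subset with at least two elements. -/
theorem BuildTree.exists_connected {o : Outcome V} (h : BuildTree U S o) (ho : o = .fail)
    (hS : IsBase U S) :
    ∃ X ⊆ U, 2 ≤ X.card ∧ ∀ u ∈ X, ∀ v ∈ X, PremiseConnected (restrict S X) u v := by
  induction h with
  | empty | single | node => cases ho
  | halt U S C hU hC hcard =>
    obtain rfl := Finset.eq_of_subset_of_card_le hC.subset hcard.ge
    exact ⟨C, subset_rfl, hU, by rw [hS.restrict_self]; exact hC.prop.2⟩
  | failLeft U S C hU hC hcard hl ih =>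
    obtain ⟨X, hX, h2, hc⟩ := ih rfl (hS.restrict C)
    rw [restrict_restrict hX] at hc
    exact ⟨X, hX.trans hC.subset, h2, hc⟩
  | failRight U S C l hU hC hcard hl hr ihl ihr =>
    obtain ⟨X, hX, h2, hc⟩ := ihr rfl (hS.restrict _)
    rw [restrict_restrict hX] at hc
    exact ⟨X, hX.trans Finset.sdiff_subset, h2, hc⟩

/-- A tree that separates all implications inside `X` shows that `X` is not premise-connected. -/
theorem LTree.Separates.not_connected {t : LTree V} (h : t.Separates) (hn : t.leaves.Nodup)
    (hX : ∀ v ∈ X, v ∈ t.leaves) (h2 : 2 ≤ X.card)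
    (hS : ∀ p ∈ restrict S X, p.1.Nonempty ∧ ∃ L ∈ t.labels, p ∈ L) :
    ∃ u ∈ X, ∃ v ∈ X, ¬ PremiseConnected (restrict S X) u v := by
  induction t with
  | leaf v =>
    have : X ⊆ {v} := fun x hx => by simpa [LTree.leaves] using hX x hx
    have := Finset.card_le_card this
    simp at this
    omega
  | node M l r ihl ihr =>
    obtain ⟨h1, hl, hr⟩ := h
    simp only [LTree.leaves, List.nodup_append, List.mem_append] at hn hX
    obtain ⟨hnl, hnr, hd⟩ := hn
    simp only [LTree.labels, List.mem_cons, List.mem_append] at hS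
    -- Descend as long as `X` lies below one child. An implication inside `X` then belongs to that
    -- child's labels: the root label would put its premise or its conclusion on the other side, and
    -- the other subtree would contain its premise.
    by_cases hXr : ∀ v ∈ X, v ∈ r.leaves
    · refine ihr hr hnr hXr fun p hp => ⟨(hS p hp).1, ?_⟩
      obtain ⟨⟨a, ha⟩, L, rfl | hL | hL, hpL⟩ := hS p hp
      · have hb := (mem_restrict.1 hp).2
        rcases h1 p hpL with ⟨h, -⟩ | ⟨-, h⟩
        · exact absurd rfl (hd _ (h a ha) _ (hXr a (hb.1 ha)))
        · exact absurd rfl (hd _ h _ (hXr _ hb.2))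
      · exact absurd rfl (hd _ (hl.mem_leaves hL hpL a ha) _
          (hXr a ((mem_restrict.1 hp).2.1 ha)))
      · exact ⟨L, hL, hpL⟩
    · by_cases hXl : ∀ v ∈ X, v ∈ l.leaves
      · refine ihl hl hnl hXl fun p hp => ⟨(hS p hp).1, ?_⟩
        obtain ⟨⟨a, ha⟩, L, rfl | hL | hL, hpL⟩ := hS p hp
        · have hb := (mem_restrict.1 hp).2
          rcases h1 p hpL with ⟨-, h⟩ | ⟨h, -⟩
          · exact absurd rfl (hd _ (hXl _ hb.2) _ h)
          · exact absurd rfl (hd _ (hXl a (hb.1 ha)) _ (h a ha))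
        · exact ⟨L, hL, hpL⟩
        · exact absurd rfl (hd _ (hXl a ((mem_restrict.1 hp).2.1 ha)) _
            (hr.mem_leaves hL hpL a ha))
      -- Here `X` meets both sides. No premise of an implication inside `X` crosses, so the left
      -- leaves are closed under premise-paths, and `u` on the left is not joined to `v` on the
      -- right.
      · push Not at hXl hXr
        obtain ⟨u, hu, hul⟩ := hXr
        obtain ⟨v, hv, hvr⟩ := hXl
        have hu' := (hX u hu).resolve_right hul
        refine ⟨u, hu, v, hv, fun hc => hvr ?_⟩
        refine mem_of_premiseConnected (P := fun x => x ∈ l.leaves) ?_ hc hu'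
        intro p hp x hx y hy hxl
        obtain ⟨-, L, rfl | hL | hL, hpL⟩ := hS p hp
        · rcases h1 p hpL with ⟨h, -⟩ | ⟨h, -⟩
          · exact h y hy
          · exact absurd rfl (hd _ hxl _ (h x hx))
        · exact hl.mem_leaves hL hpL y hy
        · exact absurd rfl (hd _ hxl _ (hr.mem_leaves hL hpL x hx))

theorem BuildTree.not_hDecomposable (h : BuildTree U S .fail) (hS : IsBase U S) :
    ¬ HDecomposable U S := by
  obtain ⟨X, hXU, h2, hc⟩ := h.exists_connected rfl hS
  rintro ⟨_ | t, hT⟩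
  · have := Finset.card_le_card hXU
    rw [hT.1, Finset.card_empty] at this
    omega
  · obtain ⟨⟨hn, hU⟩, -, hs, -, hp⟩ := hT
    obtain ⟨u, hu, v, hv, huv⟩ := hs.not_connected hn (S := S)
      (fun v hv => (hU v).2 (hXU hv)) h2
      fun p hpX => ⟨(hS p (restrict_subset hpX)).2.2, hp p (restrict_subset hpX)⟩
    exact huv (hc u hu v hv)

/-- An implication that lies in neither part is separated by a premise-connected component. -/
theorem IsPremiseComponent.separates (hC : IsPremiseComponent U S C) (hS : IsBase U S)
    {p : Implication V} (hp : p ∈ S \ (restrict S C ∪ restrict S (U \ C))) :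
    (p.1 ⊆ C ∧ p.2 ∈ U \ C) ∨ (p.1 ⊆ U \ C ∧ p.2 ∈ C) := by
  simp only [Finset.mem_sdiff, Finset.mem_union, mem_restrict, not_or, not_and] at hp
  obtain ⟨hpS, h1, h2⟩ := hp
  obtain ⟨hpU, hbU, a, ha⟩ := hS p hpS
  by_cases haC : a ∈ C
  · have hsub : p.1 ⊆ C := fun x hx =>
      hC.mem haC (hpU hx) (premiseConnected_of_mem hpS ha hx)
    exact .inl ⟨hsub, Finset.mem_sdiff.2 ⟨hbU, h1 hpS hsub⟩⟩
  · have hsub : p.1 ⊆ U \ C := fun x hx => Finset.mem_sdiff.2 ⟨hpU hx, fun hxC =>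
      haC (hC.mem hxC (hpU ha) (premiseConnected_of_mem hpS hx ha))⟩
    exact .inr ⟨hsub, by_contra (h2 hpS hsub hbU)⟩

theorem BuildTree.isSigmaTree {o : Outcome V} (h : BuildTree U S o) {T : Option (LTree V)}
    (ho : o = .ok T) (hS : IsBase U S) (hloop : ∀ a, (({a}, a) : Implication V) ∉ S) :
    IsSigmaTree U S T := by
  induction h generalizing T with
  | halt | failLeft | failRight => cases ho
  | empty S =>
    cases ho
    refine ⟨rfl, Finset.eq_empty_of_forall_notMem fun p hp => ?_⟩
    simpa using (hS p hp).2.1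
  | single v S =>
    cases ho
    -- Over a single vertex the only implication with a nonempty premise is `{v} → v`, which is
    -- excluded.
    obtain rfl : S = ∅ := Finset.eq_empty_of_forall_notMem fun p hp => by
      obtain ⟨h1, h2, h3⟩ := hS p hp
      have h4 : p = ({v}, v) := Prod.ext (h3.subset_singleton_iff.1 h1) (by simpa using h2)
      exact hloop v (h4 ▸ hp)
    simp [IsSigmaTree, LTree.leaves, LTree.labels, LTree.Separates]
  | node U S C l r hU hC hcard hl hr ihl ihr =>
    cases ho
    obtain ⟨⟨hln, hlU⟩, hlS, hls, hld, hlp⟩ := ihl rfl (hS.restrict C)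
      fun a ha => hloop a (restrict_subset ha)
    obtain ⟨⟨hrn, hrU⟩, hrS, hrs, hrd, hrp⟩ := ihr rfl (hS.restrict _)
      fun a ha => hloop a (restrict_subset ha)
    -- The conclusion alone tells the two sub-bases apart.
    have hdisj : Disjoint (restrict S C) (restrict S (U \ C)) := by
      rw [Finset.disjoint_left]
      intro p h1 h2
      exact (Finset.mem_sdiff.1 (mem_restrict.1 h2).2.2).2 (mem_restrict.1 h1).2.2
    refine ⟨⟨?_, fun v => ?_⟩, ?_, ⟨?_, hls, hrs⟩, ?_, ?_⟩
    · simp only [LTree.leaves, List.nodup_append, hlU, hrU, Finset.mem_sdiff]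
      exact ⟨hln, hrn, fun a ha b hb hab => hb.2 (hab ▸ ha)⟩
    · simp only [LTree.leaves, List.mem_append, hlU, hrU, Finset.mem_sdiff]
      have : v ∈ C → v ∈ U := fun h => hC.subset h
      tauto
    · simp only [LTree.labels, List.mem_cons, List.mem_append]
      rintro L (rfl | hL | hL)
      · exact Finset.sdiff_subset
      · exact (hlS L hL).trans restrict_subset
      · exact (hrS L hL).trans restrict_subset
    · intro p hp
      simp only [hlU, hrU]
      exact (hC.separates hS hp).imp (fun h => ⟨fun a ha => h.1 ha, h.2⟩)
        (fun h => ⟨fun a ha => h.1 ha, h.2⟩)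
    · simp only [LTree.labels, List.pairwise_cons, List.pairwise_append, List.mem_append]
      refine ⟨?_, hld, hrd, fun L hL M hM => hdisj.mono (hlS L hL) (hrS M hM)⟩
      rintro L (hL | hL)
      · exact Finset.sdiff_disjoint.mono_right ((hlS L hL).trans Finset.subset_union_left)
      · exact Finset.sdiff_disjoint.mono_right ((hrS L hL).trans Finset.subset_union_right)
    · intro p hp
      simp only [LTree.labels, List.mem_cons, List.mem_append]
      by_cases h1 : p ∈ restrict S C
      · obtain ⟨L, hL, hpL⟩ := hlp p h1
        exact ⟨L, .inr (.inl hL), hpL⟩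
      · by_cases h2 : p ∈ restrict S (U \ C)
        · obtain ⟨L, hL, hpL⟩ := hrp p h2
          exact ⟨L, .inr (.inr hL), hpL⟩
        · exact ⟨_, .inl rfl, by simp [hp, h1, h2]⟩

theorem buildTree_correct (hS : IsBase U S) (hloop : ∀ a, (({a}, a) : Implication V) ∉ S) :
    (∃ o, BuildTree U S o) ∧ ∀ o, BuildTree U S o →
      (∃ T, o = .ok T ∧ IsSigmaTree U S T) ∨ (o = .fail ∧ ¬ HDecomposable U S) := by
  refine ⟨(exists_buildTree U S).imp fun _ h => h.1, fun o ho => ?_⟩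
  cases o with
  | fail => exact .inr ⟨rfl, ho.not_hDecomposable hS⟩
  | ok T => exact .inl ⟨T, rfl, ho.isSigmaTree rfl hS hloop⟩

/-- Adding an implication merges all classes that meet its premise. -/
theorem premiseConnected_insert {p : Implication V} {u v : V} :
    PremiseConnected (insert p S) u v ↔ PremiseConnected S u v ∨
      ((∃ a ∈ p.1, PremiseConnected S a u) ∧ ∃ a ∈ p.1, PremiseConnected S a v) := by
  constructor
  · intro h
    induction h with
    | refl => exact .inl .refl
    | @tail x y hx h ih =>
      obtain ⟨q, hq, hxq, hyq⟩ := h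
      rcases Finset.mem_insert.1 hq with rfl | hq
      · refine .inr ⟨?_, y, hyq, .refl⟩
        rcases ih with ih | ih
        · exact ⟨x, hxq, premiseConnected_symm ih⟩
        · exact ih.1
      · have hxy := premiseConnected_of_mem hq hxq hyq
        exact ih.imp (fun h => h.trans hxy) fun ⟨h, a, ha, hax⟩ => ⟨h, a, ha, hax.trans hxy⟩
  · have hm : S ⊆ insert p S := Finset.subset_insert _ _
    rintro (h | ⟨⟨a, ha, hau⟩, b, hb, hbv⟩)
    · exact premiseConnected_mono hm h
    · exact ((premiseConnected_symm (premiseConnected_mono hm hau)).trans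
        (premiseConnected_of_mem (Finset.mem_insert_self _ _) ha hb)).trans
        (premiseConnected_mono hm hbv)

end Combinatorics

/-! ## Timed rules for programs that work on five arrays -/

infixr:65 " ;; " => Prog.seq

/-- The arrays of the program: block numbers of vertices, labels of components, marks of labels,
flags of implications, and the output. -/
inductive Arr where
  | col | cmp | mk | flg | out
  deriving DecidableEq

/-- Registers and arrays. -/
structure AState where
  reg : ℕ → ℕ
  arr : Arr → ℕ → ℕ

def AState.setReg (a : AState) (d x : ℕ) : AState := { a with reg := Function.update a.reg d x }

def AState.setArr (a : AState) (A : Arr) (i x : ℕ) : AState :=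
  { a with arr := Function.update a.arr A (Function.update (a.arr A) i x) }

@[simp] theorem AState.setReg_reg (a : AState) (d x r : ℕ) :
    (a.setReg d x).reg r = if r = d then x else a.reg r := Function.update_apply ..

@[simp] theorem AState.setReg_arr (a : AState) (d x : ℕ) : (a.setReg d x).arr = a.arr := rfl

@[simp] theorem AState.setArr_reg (a : AState) (A : Arr) (i x : ℕ) :
    (a.setArr A i x).reg = a.reg := rfl

theorem AState.setArr_arr (a : AState) (A A' : Arr) (i x j : ℕ) :
    (a.setArr A i x).arr A' j = if A' = A ∧ j = i then x else a.arr A' j := by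
  by_cases h : A' = A
  · subst h
    simp [AState.setArr, Function.update_apply]
  · simp [AState.setArr, h]

theorem AState.setArr_arr_ne (a : AState) {A A' : Arr} (i x : ℕ) (h : A' ≠ A) :
    (a.setArr A i x).arr A' = a.arr A' := by
  simp [AState.setArr, h]

@[simp] theorem AState.setReg_setReg_same (a : AState) (d x y : ℕ) :
    (a.setReg d x).setReg d y = a.setReg d y := by
  simp [AState.setReg]

/-- The sizes and the input: `n` vertices, `m` implications, room for `cap` words of output. -/
structure Lay where
  n : ℕ
  m : ℕ
  cap : ℕ
  space : ℕ
  word : ℕ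
  inp : ℕ → ℕ
  conclusion_lt : ∀ i < m, inp (i * (n + 1) + 2) < n
  one_le_cap : 1 ≤ cap
  space_eq : 2 + m * (n + 1) + 3 * n + m + cap ≤ space
  space_le : space < word

namespace Lay

variable (L : Lay)

/-- The premise of the implication number `i` contains `v`. -/
def prem (i v : ℕ) : Prop := L.inp (i * (L.n + 1) + 2 + 1 + v) ≠ 0

def concl (i : ℕ) : ℕ := L.inp (i * (L.n + 1) + 2)

def data : ℕ := 2 + L.m * (L.n + 1)

def base : Arr → ℕ
  | .col => L.data
  | .cmp => L.data + L.n
  | .mk => L.data + 2 * L.n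
  | .flg => L.data + 3 * L.n
  | .out => L.data + 3 * L.n + L.m

def size : Arr → ℕ
  | .flg => L.m
  | .out => L.cap
  | _ => L.n

/-- The state of the machine in which the arrays are stored one after the other behind the
input. -/
def conc (a : AState) : State where
  reg := a.reg
  mem x :=
    if x < L.base .col then L.inp x
    else if x < L.base .cmp then a.arr .col (x - L.base .col)
    else if x < L.base .mk then a.arr .cmp (x - L.base .cmp)
    else if x < L.base .flg then a.arr .mk (x - L.base .mk)
    else if x < L.base .out then a.arr .flg (x - L.base .flg)
    else a.arr .out (x - L.base .out)

variable {L}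

theorem base_add_lt {A : Arr} {i : ℕ} (hi : i < L.size A) : L.base A + i < L.space := by
  have := L.space_eq
  cases A <;> simp only [base, size, data] at * <;> omega

theorem base_lt_word (A : Arr) : L.base A < L.word := by
  have := L.space_eq
  have := L.space_le
  cases A <;> simp only [base, data] at * <;> omega

theorem conc_mem_arr (a : AState) {A : Arr} {i : ℕ} (hi : i < L.size A) :
    (L.conc a).mem (L.base A + i) = a.arr A i := by
  cases A <;> simp only [base, size, conc] at * <;> grind

theorem conc_mem_inp (a : AState) {x : ℕ} (hx : x < L.data) : (L.conc a).mem x = L.inp x := by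
  simp only [conc]
  exact if_pos hx

theorem conc_setReg (a : AState) (d x : ℕ) : L.conc (a.setReg d x) = (L.conc a).setReg d x := rfl

/-- The arrays occupy consecutive disjoint intervals. The bound on `i` keeps the write from running
into the next array. -/
theorem conc_setArr (a : AState) {A : Arr} {i : ℕ} (hi : i < L.size A) (x : ℕ) :
    L.conc (a.setArr A i x) = (L.conc a).setMem (L.base A + i) x := by
  simp only [conc, State.setMem, AState.setArr_reg, State.mk.injEq, true_and]
  funext y
  simp only [Function.update_apply, AState.setArr_arr]
  cases A <;> simp only [base, size, reduceCtorEq, false_and, if_false, true_and] at * <;>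
    grind

end Lay

/-- Started in `a`, the program `P` halts within `T` steps in a state with the property `Q`. -/
def Tr (L : Lay) (P : Prog) (T : ℕ) (a : AState) (Q : AState → Prop) : Prop :=
  ∃ b t, Exec L.space L.word P (L.conc a) (L.conc b) t ∧ t ≤ T ∧ Q b

section Rules

variable {L : Lay} {P R : Prog} {T T₁ T₂ : ℕ} {a : AState} {Q Q' : AState → Prop}

theorem Tr.mono (h : Tr L P T₁ a Q) (hT : T₁ ≤ T) (hQ : ∀ b, Q b → Q' b) : Tr L P T a Q' := by
  obtain ⟨b, t, h1, h2, h3⟩ := h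
  exact ⟨b, t, h1, h2.trans hT, hQ b h3⟩

theorem Tr.skip (h : Q a) : Tr L .skip 1 a Q := ⟨a, 1, .skip _, le_rfl, h⟩

theorem Tr.const {d k : ℕ} (hk : k < L.word) (h : Q (a.setReg d k)) :
    Tr L (.const d k) 1 a Q :=
  ⟨a.setReg d k, 1, .const _ _ _ hk, le_rfl, h⟩

theorem Tr.op {o : BinOp} {d x y z : ℕ} (hz : o.eval (a.reg x) (a.reg y) = z)
    (hw : z < L.word) (h : Q (a.setReg d z)) : Tr L (.op o d x y) 1 a Q := by
  subst hz
  exact ⟨_, 1, .op (L.conc a) o d x y hw, le_rfl, h⟩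

theorem Tr.seq (h : Tr L P T₁ a fun b => Tr L R T₂ b Q) (hT : T₁ + T₂ ≤ T) :
    Tr L (P ;; R) T a Q := by
  obtain ⟨b, t, h1, h2, c, t', h3, h4, h5⟩ := h
  exact ⟨c, t + t', .seq h1 h3, by omega, h5⟩

theorem Tr.cond {r : ℕ} (h1 : a.reg r ≠ 0 → Tr L P T a Q) (h0 : a.reg r = 0 → Tr L R T a Q) :
    Tr L (.cond r P R) (T + 1) a Q := by
  by_cases h : a.reg r = 0
  · obtain ⟨b, t, h2, h3, h4⟩ := h0 h
    exact ⟨b, t + 1, .condFalse h h2, by omega, h4⟩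
  · obtain ⟨b, t, h2, h3, h4⟩ := h1 h
    exact ⟨b, t + 1, .condTrue h h2, by omega, h4⟩

theorem Tr.const_seq {d k : ℕ} (hk : k < L.word) (h : Tr L R T (a.setReg d k) Q) :
    Tr L (.const d k ;; R) (T + 1) a Q :=
  .seq (T₁ := 1) (T₂ := T) (.const hk h) (by omega)

theorem Tr.op_seq {o : BinOp} {d x y z : ℕ} (hz : o.eval (a.reg x) (a.reg y) = z)
    (hw : z < L.word) (h : Tr L R T (a.setReg d z) Q) :
    Tr L (.op o d x y ;; R) (T + 1) a Q :=
  .seq (T₁ := 1) (T₂ := T) (.op hz hw h) (by omega)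

/-- The loop `for i = 0, …, R lim - 1 do body`, where `R 4 = 1` and `g` holds the test. -/
def forLoop (i g lim : ℕ) (body : Prog) : Prog :=
  .const i 0 ;; .op .lt g i lim ;; .loop g (body ;; .op .add i i 4 ;; .op .lt g i lim)

/-- Counter and test register change between rounds, so the invariant must be insensitive to them
(`hst`); the value of the counter is tracked by a separate equation. Each round pays 3 steps for
loop test, increment and comparison; the final 3 are the initialisation, the first comparison and
the last test. The proof is by induction on the number of remaining rounds. -/
theorem Tr.forLoop {i g lim N : ℕ} {body : Prog} (Inv : ℕ → AState → Prop)
    (hig : i ≠ g ∧ lim ≠ g ∧ lim ≠ i ∧ 4 ≠ i ∧ 4 ≠ g)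
    (hN : N < L.word)
    (hInv : ∀ j b, Inv j b → b.reg lim = N ∧ b.reg 4 = 1)
    (hst : ∀ j b x y, Inv j b → Inv j ((b.setReg i x).setReg g y))
    (h0 : Inv 0 a)
    (hbody : ∀ j < N, ∀ b, b.reg i = j → Inv j b →
      Tr L body T b fun c => c.reg i = j ∧ Inv (j + 1) c)
    (hQ : ∀ b, Inv N b → Q b) :
    Tr L (HDecomp.forLoop i g lim body) (N * (T + 3) + 3) a Q := by
  obtain ⟨hig, hlg, hli, h4i, h4g⟩ := hig
  have h2w : 1 < L.word := by
    have := L.space_le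
    have := L.space_eq
    omega
  have key : ∀ k j b, j + k = N → b.reg i = j → b.reg g = (if j < N then 1 else 0) → Inv j b →
      Tr L (.loop g (body ;; .op .add i i 4 ;; .op .lt g i lim)) (k * (T + 3) + 1) b Q := by
    intro k
    induction k with
    | zero =>
      intro j b hj _ hg hb
      refine ⟨b, 1, .loopDone ?_, by omega, hQ b ?_⟩
      · exact hg.trans (if_neg (by omega))
      · rwa [← hj]
    | succ k ih =>
      intro j b hj hi hg hb
      obtain ⟨c, t, h1, h2, hci, hc⟩ := hbody j (by omega) b hi hb
      obtain ⟨hcl, hc4⟩ := hInv _ _ hc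
      obtain ⟨d, t', h3, h4, h5⟩ := ih (j + 1)
        ((c.setReg i (j + 1)).setReg g (if j + 1 < N then 1 else 0)) (by omega)
        (by simp [hig]) (by simp) (hst _ _ _ _ hc)
      refine ⟨d, (t + (1 + 1)) + t' + 1, .loopStep ?_ (.seq h1 (.seq (s₂ := L.conc
        (c.setReg i (j + 1))) ?_ ?_)) h3, ?_, h5⟩
      · change b.reg g ≠ 0
        rw [hg, if_pos (by omega)]
        omega
      · have := Exec.op (space := L.space) (word := L.word) (L.conc c) .add i i 4
          (by change c.reg i + c.reg 4 < _; omega)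
        have e : BinOp.add.eval ((L.conc c).reg i) ((L.conc c).reg 4) = j + 1 := by
          change c.reg i + c.reg 4 = _
          omega
        rw [e] at this
        exact this
      · have e : BinOp.lt.eval ((L.conc (c.setReg i (j + 1))).reg i)
            ((L.conc (c.setReg i (j + 1))).reg lim) = if j + 1 < N then 1 else 0 := by
          change (if (c.setReg i (j + 1)).reg i < (c.setReg i (j + 1)).reg lim then 1 else 0) = _
          simp [hli, hcl]
        have := Exec.op (space := L.space) (word := L.word) (L.conc (c.setReg i (j + 1)))
          .lt g i lim (by rw [e]; split_ifs <;> omega)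
        rw [e] at this
        exact this
      · have : (k + 1) * (T + 3) = k * (T + 3) + T + 3 := by ring
        omega
  obtain ⟨hl, h4⟩ := hInv _ _ h0
  refine Tr.const_seq (T := N * (T + 3) + 2) (by omega) (Tr.op_seq (z := if 0 < N then 1 else 0)
    (T := N * (T + 3) + 1) ?_ (by split_ifs <;> omega) ?_)
  · simp [BinOp.eval, hli, hl]
  · exact key N 0 _ (by omega) (by simp [hig]) (by simp) (hst _ _ _ _ h0)

end Rules

/-! ## Standing registers and array accesses -/

/-- The register that holds the base address of an array. -/
def breg : Arr → ℕ
  | .col => 6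
  | .cmp => 7
  | .mk => 8
  | .flg => 9
  | .out => 0

/-- The registers that are constant during the main loop. -/
structure Std (L : Lay) (a : AState) : Prop where
  base : ∀ A, a.reg (breg A) = L.base A
  vertices : a.reg 2 = L.n
  implications : a.reg 3 = L.m
  one : a.reg 4 = 1
  width : a.reg 5 = L.n + 1
  zero : a.reg 10 = 0
  two : a.reg 11 = 2

/-- The registers below `k` agree. -/
def Frame (k : ℕ) (a b : AState) : Prop := ∀ r < k, b.reg r = a.reg r

theorem Frame.refl (k : ℕ) (a : AState) : Frame k a a := fun _ _ => rfl

theorem Frame.trans {k : ℕ} {a b c : AState} (h : Frame k a b) (h' : Frame k b c) :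
    Frame k a c := fun r hr => (h' r hr).trans (h r hr)

theorem Frame.mono {k l : ℕ} {a b : AState} (h : Frame k a b) (hl : l ≤ k) : Frame l a b :=
  fun r hr => h r (by omega)

theorem Frame.setReg {k d x : ℕ} {a b : AState} (h : Frame k a b) (hd : k ≤ d) :
    Frame k a (b.setReg d x) := fun r hr => by
  rw [AState.setReg_reg, if_neg (by omega)]
  exact h r hr

theorem Frame.setArr {k i x : ℕ} {A : Arr} {a b : AState} (h : Frame k a b) :
    Frame k a (b.setArr A i x) := h

/-- Register 1 holds the length of the output and varies; all other registers below 12 hold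
constants. -/
theorem Std.setReg {L : Lay} {a : AState} (h : Std L a) {d : ℕ} (x : ℕ)
    (hd : 12 ≤ d ∨ d = 1) : Std L (a.setReg d x) := by
  have key : ∀ r, r < 12 → r ≠ 1 → (a.setReg d x).reg r = a.reg r := by
    intro r h1 h2
    rw [AState.setReg_reg, if_neg (by omega)]
  constructor
  · intro A
    rw [key _ (by cases A <;> simp [breg]) (by cases A <;> simp [breg])]
    exact h.base A
  all_goals rw [key _ (by omega) (by omega)]
  exacts [h.vertices, h.implications, h.one, h.width, h.zero, h.two]

theorem Std.setArr {L : Lay} {a : AState} (h : Std L a) (A : Arr) (i x : ℕ) :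
    Std L (a.setArr A i x) := ⟨h.1, h.2, h.3, h.4, h.5, h.6, h.7⟩

theorem Std.of_frame {L : Lay} {a b : AState} (h : Std L a) {k : ℕ} (hf : Frame k a b)
    (hk : 12 ≤ k) : Std L b := by
  constructor
  · intro A
    rw [hf _ (by cases A <;> simp [breg] <;> omega)]
    exact h.base A
  all_goals rw [hf _ (by omega)]
  exacts [h.vertices, h.implications, h.one, h.width, h.zero, h.two]

/-- `R d := A[R x]` -/
def rd (A : Arr) (d x : ℕ) : Prog := .op .add d (breg A) x ;; .load d d

/-- `A[R x] := R y` -/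
def wr (A : Arr) (x y : ℕ) : Prog := .op .add 40 (breg A) x ;; .store 40 y

section Access

variable {L : Lay} {R : Prog} {T : ℕ} {a : AState} {Q : AState → Prop} {A : Arr}

theorem Tr.rd {d x i : ℕ} (hs : Std L a) (hx : a.reg x = i) (hi : i < L.size A)
    (h : Q (a.setReg d (a.arr A i))) : Tr L (HDecomp.rd A d x) 2 a Q := by
  have hsp := Lay.base_add_lt hi
  refine .op_seq (T := 1) (z := L.base A + i) (by simp [BinOp.eval, hs.base, hx])
    (hsp.trans L.space_le) ?_
  have e : (L.conc (a.setReg d (L.base A + i))).reg d = L.base A + i := by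
    change (a.setReg d (L.base A + i)).reg d = _
    simp
  have := Exec.load (space := L.space) (word := L.word) (L.conc (a.setReg d (L.base A + i))) d d
    (by rwa [e])
  rw [e, Lay.conc_mem_arr _ hi, ← Lay.conc_setReg, AState.setReg_setReg_same] at this
  exact ⟨_, 1, this, le_rfl, h⟩

/-- Register 40 receives the address, so the value to be stored must come from another register. -/
theorem Tr.wr {x y i : ℕ} (hs : Std L a) (hx : a.reg x = i) (hi : i < L.size A) (hy : y ≠ 40)
    (h : Q ((a.setReg 40 (L.base A + i)).setArr A i (a.reg y))) :
    Tr L (HDecomp.wr A x y) 2 a Q := by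
  have hsp := Lay.base_add_lt hi
  refine .op_seq (T := 1) (z := L.base A + i) (by simp [BinOp.eval, hs.base, hx])
    (hsp.trans L.space_le) ?_
  have e : (L.conc (a.setReg 40 (L.base A + i))).reg 40 = L.base A + i := by
    change (a.setReg 40 (L.base A + i)).reg 40 = _
    simp
  have e' : (L.conc (a.setReg 40 (L.base A + i))).reg y = a.reg y := by
    change (a.setReg 40 (L.base A + i)).reg y = _
    simp [hy]
  have := Exec.store (space := L.space) (word := L.word)
    (L.conc (a.setReg 40 (L.base A + i))) 40 y (by rwa [e])
  rw [e, e', ← Lay.conc_setArr _ hi] at this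
  exact ⟨_, 1, this, le_rfl, h⟩

theorem Tr.load_inp {d x i : ℕ} (hx : a.reg x = i) (hi : i < L.data)
    (h : Q (a.setReg d (L.inp i))) : Tr L (.load d x) 1 a Q := by
  have hsp : i < L.space := by
    have := L.space_eq
    simp only [Lay.data] at hi
    omega
  have := Exec.load (space := L.space) (word := L.word) (L.conc a) d x
    (by change a.reg x < _; rwa [hx])
  have e : (L.conc a).reg x = i := hx
  rw [e, Lay.conc_mem_inp _ hi, ← Lay.conc_setReg] at this
  exact ⟨_, 1, this, le_rfl, h⟩

theorem Tr.rd_seq {d x i : ℕ} (hs : Std L a) (hx : a.reg x = i) (hi : i < L.size A)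
    (h : Tr L R T (a.setReg d (a.arr A i)) Q) : Tr L (HDecomp.rd A d x ;; R) (T + 2) a Q :=
  .seq (T₁ := 2) (T₂ := T) (.rd hs hx hi h) (by omega)

theorem Tr.wr_seq {x y i : ℕ} (hs : Std L a) (hx : a.reg x = i) (hi : i < L.size A) (hy : y ≠ 40)
    (h : Tr L R T ((a.setReg 40 (L.base A + i)).setArr A i (a.reg y)) Q) :
    Tr L (HDecomp.wr A x y ;; R) (T + 2) a Q :=
  .seq (T₁ := 2) (T₂ := T) (.wr hs hx hi hy h) (by omega)

theorem Tr.load_inp_seq {d x i : ℕ} (hx : a.reg x = i) (hi : i < L.data)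
    (h : Tr L R T (a.setReg d (L.inp i)) Q) : Tr L (.load d x ;; R) (T + 1) a Q :=
  .seq (T₁ := 1) (T₂ := T) (.load_inp hx hi h) (by omega)

end Access

/-! ## Parts of the program -/

section Parts

variable {L : Lay} {a : AState} {Q : AState → Prop}

theorem Lay.row_le {i : ℕ} (hi : i < L.m) : i * (L.n + 1) + (L.n + 1) + 2 ≤ L.data := by
  have := Nat.mul_le_mul_right (L.n + 1) (Nat.succ_le_of_lt hi)
  rw [Nat.succ_mul] at this
  simp only [data]
  omega

theorem Lay.data_lt_word : L.data + L.n + L.m + 2 < L.word + 2 ∧ 2 ≤ L.data ∧ 2 < L.word := by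
  have := L.space_eq
  have := L.space_le
  have := L.one_le_cap
  simp only [data]
  omega

/-- The implication number `i` lies inside the set of vertices `v` with `f v = c`. -/
def Inside (L : Lay) (f : ℕ → ℕ) (c i : ℕ) : Prop :=
  f (L.concl i) = c ∧ ∀ v < L.n, L.prem i v → f v = c

/-- Test whether the implication number `R 20` lies inside the block number `R 21`. -/
def checkInside : Prog :=
  .op .mul 31 20 5 ;; .op .add 31 31 11 ;; .load 32 31 ;; rd .col 32 32 ;; .op .eq 30 32 21 ;;
  forLoop 33 34 2 (.op .add 31 31 4 ;; .load 32 31 ;;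
    .cond 32 (rd .col 35 33 ;; .op .eq 35 35 21 ;; .op .mul 30 30 35) .skip)

/-- Register 30 starts as the test of the conclusion and is multiplied by the test of each premise
element. A product of zeros and ones implements the conjunction and cannot overflow. -/
theorem Tr.checkInside {i : ℕ} (hs : Std L a) (hi : a.reg 20 = i) (him : i < L.m)
    (hQ : ∀ b, Frame 30 a b → b.arr = a.arr → b.reg 30 ≤ 1 →
      (b.reg 30 ≠ 0 ↔ Inside L (a.arr .col) (a.reg 21) i) → Q b) :
    Tr L HDecomp.checkInside (L.n * 10 + 9) a Q := by
  have hrow := Lay.row_le him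
  obtain ⟨hdw, -, h2w⟩ := L.data_lt_word
  have hc : L.concl i < L.n := L.conclusion_lt i him
  refine .op_seq (z := i * (L.n + 1)) (by simp [BinOp.eval, hi, hs.width]) (by omega) ?_
  have hs1 := hs.setReg (d := 31) (i * (L.n + 1)) (by omega)
  refine .op_seq (z := i * (L.n + 1) + 2) (by simp [BinOp.eval, hs.two]) (by omega) ?_
  refine .load_inp_seq (i := i * (L.n + 1) + 2) (by simp) (by omega) ?_
  refine .rd_seq (i := L.concl i) (((hs1.setReg _ ?_).setReg _ ?_)) (by simp [Lay.concl]) hc ?_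
  · omega
  · omega
  simp only [AState.setReg_arr, AState.setReg_setReg_same]
  refine .op_seq (z := if a.arr .col (L.concl i) = a.reg 21 then 1 else 0)
    (by simp [BinOp.eval]) (by split_ifs <;> omega) ?_
  refine Tr.forLoop (N := L.n) (T := 7) (fun j b => Frame 30 a b ∧ b.arr = a.arr ∧
    b.reg 31 = i * (L.n + 1) + 2 + j ∧ b.reg 30 ≤ 1 ∧ (b.reg 30 ≠ 0 ↔
      a.arr .col (L.concl i) = a.reg 21 ∧ ∀ v < j, L.prem i v → a.arr .col v = a.reg 21))
    (by omega) (by omega) ?_ ?_ ?_ ?_ ?_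
  · rintro j b ⟨hf, -⟩
    exact ⟨(hf 2 (by omega)).trans hs.vertices, (hf 4 (by omega)).trans hs.one⟩
  · rintro j b x y ⟨hf, h⟩
    exact ⟨(hf.setReg (by omega)).setReg (by omega), by simpa using h⟩
  · refine ⟨((((Frame.refl 30 a).setReg ?_).setReg ?_).setReg ?_), by simp, by simp, ?_, ?_⟩
    iterate 3 omega
    · simp only [AState.setReg_reg, if_true]
      split_ifs <;> omega
    · simp
  · rintro j hj b hb ⟨hf, harr, h31, h30, hiff⟩
    have hsb := hs.of_frame hf (by omega)
    have h21 : b.reg 21 = a.reg 21 := hf _ (by omega)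
    -- The pointer starts at the conclusion, which precedes the characteristic vector in its row,
    -- and is advanced before each read; hence the offset `1 + j`.
    refine .op_seq (z := i * (L.n + 1) + 2 + 1 + j)
      (by simp [BinOp.eval, h31, hsb.one]; omega) (by omega) ?_
    refine .load_inp_seq (i := i * (L.n + 1) + 2 + 1 + j) (by simp) (by omega) ?_
    refine .cond (T := 4) ?_ ?_
    · intro hp
      simp only [AState.setReg_reg, if_true] at hp
      refine .rd_seq (i := j) ((hsb.setReg _ ?_).setReg _ ?_) (by simpa using hb) hj ?_
      · omega
      · omega
      refine .op_seq (z := if a.arr .col j = a.reg 21 then 1 else 0)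
        (by simp [BinOp.eval, harr, h21]) (by split_ifs <;> omega) ?_
      refine .op (z := b.reg 30 * if a.arr .col j = a.reg 21 then 1 else 0)
        (by simp [BinOp.eval]) (by split_ifs <;> omega) ⟨by simpa using hb, ?_, ?_, ?_, ?_, ?_⟩
      · exact ((((hf.setReg (by omega)).setReg (by omega)).setReg (by omega)).setReg
          (by omega)).setReg (by omega)
      · simpa using harr
      · simp
        omega
      · simp only [AState.setReg_reg, if_true]
        split_ifs <;> omega
      · simp only [AState.setReg_reg, if_true, Nat.forall_lt_succ_right, ← and_assoc]
        rw [← hiff]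
        have : L.prem i j := hp
        by_cases h : a.arr .col j = a.reg 21 <;> simp [h, this]
    · intro hp
      simp only [AState.setReg_reg, if_true] at hp
      refine Tr.mono (T₁ := 1) (.skip (Q := fun c => _) ⟨by simpa using hb, ?_, ?_, ?_, ?_, ?_⟩)
        (by omega) (fun _ h => h)
      · exact (hf.setReg (by omega)).setReg (by omega)
      · simpa using harr
      · simp
        omega
      · simpa using h30
      · simp only [AState.setReg_reg, Nat.forall_lt_succ_right, ← and_assoc]
        have : ¬ L.prem i j := fun h => h hp
        simpa [this] using hiff
  · rintro b ⟨hf, harr, -, h30, hiff⟩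
    exact hQ b hf harr h30 hiff

end Parts

/-! ### Merging the label classes that meet a premise -/

section Merge

variable {L : Lay} {a : AState} {Q : AState → Prop}

/-- Some element of the premise of the implication number `i` has the label `x`. -/
def Hit (L : Lay) (f : ℕ → ℕ) (i x : ℕ) : Prop := ∃ v < L.n, L.prem i v ∧ f v = x

def clearMarks : Prog := forLoop 33 34 2 (wr .mk 33 10)

theorem Tr.clearMarks (hs : Std L a)
    (hQ : ∀ b, Frame 30 a b → (∀ A, A ≠ .mk → b.arr A = a.arr A) →
      (∀ x < L.n, b.arr .mk x = 0) → Q b) :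
    Tr L HDecomp.clearMarks (L.n * 5 + 3) a Q := by
  obtain ⟨hdw, -, h2w⟩ := L.data_lt_word
  refine Tr.forLoop (N := L.n) (T := 2) (fun j b => Frame 30 a b ∧
    (∀ A, A ≠ .mk → b.arr A = a.arr A) ∧ ∀ x < j, b.arr .mk x = 0)
    (by omega) (by omega) ?_ ?_ ⟨.refl _ _, fun _ _ => rfl, by simp⟩ ?_ ?_
  · rintro j b ⟨hf, -⟩
    exact ⟨(hf 2 (by omega)).trans hs.vertices, (hf 4 (by omega)).trans hs.one⟩
  · rintro j b x y ⟨hf, h⟩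
    exact ⟨(hf.setReg (by omega)).setReg (by omega), by simpa using h⟩
  · rintro j hj b hb ⟨hf, harr, hmk⟩
    have hsb := hs.of_frame hf (by omega)
    refine .wr hsb hb hj (by omega) ⟨by simpa using hb, (hf.setReg (by omega)).setArr, ?_, ?_⟩
    · intro A hA
      rw [AState.setArr_arr_ne _ _ _ hA]
      exact harr A hA
    · intro x hx
      rw [AState.setArr_arr]
      split_ifs with h
      · exact hsb.zero
      · exact hmk x (by simp at h; omega)
  · rintro b ⟨hf, harr, hmk⟩
    exact hQ b hf harr hmk

def markLabels : Prog :=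
  .op .mul 31 20 5 ;; .op .add 31 31 11 ;;
  forLoop 33 34 2 (.op .add 31 31 4 ;; .load 32 31 ;;
    .cond 32 (rd .cmp 36 33 ;; wr .mk 36 4) .skip)

/-- Register 36 keeps the last label met, which becomes the common label. The conditional form of
its property covers an empty premise: the register is then stale, but no label is marked and it is
never used. -/
theorem Tr.markLabels {i : ℕ} (hs : Std L a) (hi : a.reg 20 = i) (him : i < L.m)
    (hlt : ∀ u < L.n, a.arr .cmp u < L.n) (hmk : ∀ x < L.n, a.arr .mk x = 0)
    (hQ : ∀ b, Frame 30 a b → (∀ A, A ≠ .mk → b.arr A = a.arr A) →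
      (∀ x < L.n, b.arr .mk x ≠ 0 ↔ Hit L (a.arr .cmp) i x) →
      (∀ x, Hit L (a.arr .cmp) i x → Hit L (a.arr .cmp) i (b.reg 36)) → Q b) :
    Tr L HDecomp.markLabels (L.n * 10 + 5) a Q := by
  have hrow := Lay.row_le him
  obtain ⟨hdw, -, h2w⟩ := L.data_lt_word
  refine .op_seq (z := i * (L.n + 1)) (by simp [BinOp.eval, hi, hs.width]) (by omega) ?_
  refine .op_seq (z := i * (L.n + 1) + 2) (by simp [BinOp.eval, hs.two]) (by omega) ?_
  refine Tr.forLoop (N := L.n) (T := 7) (fun j b => Frame 30 a b ∧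
    (∀ A, A ≠ .mk → b.arr A = a.arr A) ∧ b.reg 31 = i * (L.n + 1) + 2 + j ∧
    (∀ x < L.n, b.arr .mk x ≠ 0 ↔ ∃ v < j, L.prem i v ∧ a.arr .cmp v = x) ∧
    ∀ x, (∃ v < j, L.prem i v ∧ a.arr .cmp v = x) →
      ∃ v < j, L.prem i v ∧ a.arr .cmp v = b.reg 36)
    (by omega) (by omega) ?_ ?_ ?_ ?_ ?_
  · rintro j b ⟨hf, -⟩
    exact ⟨(hf 2 (by omega)).trans hs.vertices, (hf 4 (by omega)).trans hs.one⟩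
  · rintro j b x y ⟨hf, h⟩
    exact ⟨(hf.setReg (by omega)).setReg (by omega), by simpa using h⟩
  · refine ⟨((Frame.refl 30 a).setReg ?_).setReg ?_, by simp, by simp, ?_, by simp⟩
    · omega
    · omega
    · intro x hx
      simp [hmk x hx]
  · rintro j hj b hb ⟨hf, harr, h31, hiff, hr⟩
    have hsb := hs.of_frame hf (by omega)
    refine .op_seq (z := i * (L.n + 1) + 2 + 1 + j)
      (by simp [BinOp.eval, h31, hsb.one]; omega) (by omega) ?_
    refine .load_inp_seq (i := i * (L.n + 1) + 2 + 1 + j) (by simp) (by omega) ?_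
    have hsb' := (hsb.setReg (d := 31) (i * (L.n + 1) + 2 + 1 + j) (by omega)).setReg (d := 32)
      (L.inp (i * (L.n + 1) + 2 + 1 + j)) (by omega)
    have hcmp := harr .cmp (by simp)
    refine .cond (T := 4) ?_ ?_
    · intro hp
      simp only [AState.setReg_reg, if_true] at hp
      refine .rd_seq (i := j) hsb' (by simpa using hb) hj ?_
      refine .wr (i := a.arr .cmp j) (hsb'.setReg _ (by omega)) (by simp [hcmp]) (hlt j hj)
        (by omega) ⟨by simpa using hb, ?_, ?_, ?_, ?_, ?_⟩
      · exact ((((hf.setReg (by omega)).setReg (by omega)).setReg (by omega)).setReg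
          (by omega)).setArr
      · intro A hA
        rw [AState.setArr_arr_ne _ _ _ hA]
        exact harr A hA
      · simp
        omega
      · intro x hx
        rw [AState.setArr_arr]
        simp only [AState.setReg_arr, true_and]
        by_cases h : x = a.arr .cmp j
        · simp only [h, if_true, AState.setReg_reg, hsb.one]
          simpa using ⟨j, le_rfl, hp, rfl⟩
        · rw [if_neg h, hiff x hx]
          constructor
          · rintro ⟨v, hv, h⟩
            exact ⟨v, by omega, h⟩
          · rintro ⟨v, hv, h1, h2⟩
            rcases Nat.lt_succ_iff_lt_or_eq.1 hv with hv | rfl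
            · exact ⟨v, hv, h1, h2⟩
            · exact absurd h2.symm h
      · rintro x -
        exact ⟨j, by omega, hp, by simp [hcmp]⟩
    · intro hp
      simp only [AState.setReg_reg, if_true] at hp
      have hp' : ¬ L.prem i j := fun h => h hp
      have hex : ∀ x, (∃ v < j + 1, L.prem i v ∧ a.arr .cmp v = x) ↔
          ∃ v < j, L.prem i v ∧ a.arr .cmp v = x := by
        intro x
        constructor
        · rintro ⟨v, hv, h1, h2⟩
          rcases Nat.lt_succ_iff_lt_or_eq.1 hv with hv | rfl
          · exact ⟨v, hv, h1, h2⟩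
          · exact absurd h1 hp'
        · rintro ⟨v, hv, h⟩
          exact ⟨v, by omega, h⟩
      refine Tr.mono (T₁ := 1) (.skip (Q := fun c => _) ⟨by simpa using hb, ?_, ?_, ?_, ?_, ?_⟩)
        (by omega) (fun _ h => h)
      · exact (hf.setReg (by omega)).setReg (by omega)
      · simpa using harr
      · simp
        omega
      · intro x hx
        rw [hex]
        exact hiff x hx
      · intro x
        rw [hex, hex]
        simpa using hr x
  · rintro b ⟨hf, harr, -, hiff, hr⟩
    exact hQ b hf harr hiff hr

def relabel : Prog :=
  forLoop 33 34 2 (rd .cmp 32 33 ;; rd .mk 35 32 ;; .cond 35 (wr .cmp 33 36) .skip)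

theorem Tr.relabel (hs : Std L a) (hlt : ∀ u < L.n, a.arr .cmp u < L.n)
    (hQ : ∀ b, Frame 30 a b → (∀ A, A ≠ .cmp → b.arr A = a.arr A) →
      (∀ u < L.n, b.arr .cmp u =
        if a.arr .mk (a.arr .cmp u) ≠ 0 then a.reg 36 else a.arr .cmp u) → Q b) :
    Tr L HDecomp.relabel (L.n * 10 + 3) a Q := by
  obtain ⟨hdw, -, h2w⟩ := L.data_lt_word
  -- Relabelling in place is sound because entry `j` is still the original one when round `j` reads
  -- it; marks are always looked up at original labels.
  refine Tr.forLoop (N := L.n) (T := 7) (fun j b => Frame 30 a b ∧ b.reg 36 = a.reg 36 ∧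
    (∀ A, A ≠ .cmp → b.arr A = a.arr A) ∧ ∀ u < L.n, b.arr .cmp u =
      if u < j ∧ a.arr .mk (a.arr .cmp u) ≠ 0 then a.reg 36 else a.arr .cmp u)
    (by omega) (by omega) ?_ ?_ ⟨.refl _ _, rfl, fun _ _ => rfl, by simp⟩ ?_ ?_
  · rintro j b ⟨hf, -⟩
    exact ⟨(hf 2 (by omega)).trans hs.vertices, (hf 4 (by omega)).trans hs.one⟩
  · rintro j b x y ⟨hf, h⟩
    exact ⟨(hf.setReg (by omega)).setReg (by omega), by simpa using h⟩
  · rintro j hj b hb ⟨hf, h36, harr, hcmp⟩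
    have hsb := hs.of_frame hf (by omega)
    have hj' : b.arr .cmp j = a.arr .cmp j := by simp [hcmp j hj]
    refine .rd_seq (i := j) hsb hb hj ?_
    refine .rd_seq (i := a.arr .cmp j) (hsb.setReg _ (by omega)) (by simp [hj']) (hlt j hj) ?_
    simp only [AState.setReg_arr, harr .mk (by simp)]
    refine .cond (T := 2) ?_ ?_
    · intro hp
      simp only [AState.setReg_reg, if_true] at hp
      refine .wr (i := j) ((hsb.setReg _ ?_).setReg _ ?_) (by simpa using hb) hj
        (by omega) ⟨by simpa using hb, ?_, by simpa using h36, ?_, ?_⟩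
      · omega
      · omega
      · exact (((hf.setReg (by omega)).setReg (by omega)).setReg (by omega)).setArr
      · intro A hA
        rw [AState.setArr_arr_ne _ _ _ hA]
        exact harr A hA
      · intro u hu
        rw [AState.setArr_arr]
        by_cases h : u = j
        · subst h
          simp [hp, h36]
        · have e : u < j + 1 ↔ u < j := by omega
          simp [h, e, hcmp u hu]
    · intro hp
      simp only [AState.setReg_reg, if_true] at hp
      refine Tr.mono (T₁ := 1) (.skip (Q := fun c => _) ⟨by simpa using hb, ?_,
        by simpa using h36, by simpa using harr, ?_⟩) (by omega) (fun _ h => h)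
      · exact (hf.setReg (by omega)).setReg (by omega)
      · intro u hu
        simp only [AState.setReg_arr]
        by_cases h : u = j
        · subst h
          simp [hp, hj']
        · have e : u < j + 1 ↔ u < j := by omega
          simp [e, hcmp u hu]
  · rintro b ⟨hf, -, harr, hcmp⟩
    refine hQ b hf harr fun u hu => ?_
    rw [hcmp u hu]
    simp [hu]

/-- Give a common label to all vertices whose label occurs in the premise of the implication
number `R 20`. -/
def mergePremise : Prog := clearMarks ;; markLabels ;; relabel

/-- The common label is itself one of the labels met by the premise, so it cannot collide with the
label of an untouched class. The resulting equivalence has exactly the shape of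
`premiseConnected_insert`. -/
theorem Tr.mergePremise {i : ℕ} (hs : Std L a) (hi : a.reg 20 = i) (him : i < L.m)
    (hlt : ∀ u < L.n, a.arr .cmp u < L.n)
    (hQ : ∀ b, Frame 30 a b → (∀ A, A ≠ .cmp → A ≠ .mk → b.arr A = a.arr A) →
      (∀ u < L.n, b.arr .cmp u < L.n) →
      (∀ u < L.n, ∀ v < L.n, b.arr .cmp u = b.arr .cmp v ↔ a.arr .cmp u = a.arr .cmp v ∨
        (Hit L (a.arr .cmp) i (a.arr .cmp u) ∧ Hit L (a.arr .cmp) i (a.arr .cmp v))) → Q b) :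
    Tr L HDecomp.mergePremise (L.n * 25 + 11) a Q := by
  refine .seq (T₁ := L.n * 5 + 3) (T₂ := L.n * 20 + 8) (.clearMarks hs ?_) (by omega)
  intro b hfb hab hmk
  have hsb := hs.of_frame hfb (by omega)
  have hcb := hab .cmp (by simp)
  refine .seq (T₁ := L.n * 10 + 5) (T₂ := L.n * 10 + 3)
    (.markLabels hsb ((hfb _ (by omega)).trans hi) him (by rwa [hcb]) hmk ?_) (by omega)
  intro c hfc hac hmc hr
  have hsc := hsb.of_frame hfc (by omega)
  have hcc : c.arr .cmp = a.arr .cmp := (hac .cmp (by simp)).trans hcb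
  rw [hcb] at hmc hr
  refine .relabel hsc (by rwa [hcc]) ?_
  intro d hfd had hcd
  rw [hcc] at hcd
  have hval : ∀ u < L.n, (Hit L (a.arr .cmp) i (a.arr .cmp u) ∧ d.arr .cmp u = c.reg 36 ∧
      Hit L (a.arr .cmp) i (c.reg 36)) ∨ (¬ Hit L (a.arr .cmp) i (a.arr .cmp u) ∧
      d.arr .cmp u = a.arr .cmp u) := by
    intro u hu
    have h := hmc _ (hlt u hu)
    by_cases hh : Hit L (a.arr .cmp) i (a.arr .cmp u)
    · exact .inl ⟨hh, by rw [hcd u hu, if_pos (h.2 hh)], hr _ hh⟩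
    · exact .inr ⟨hh, by rw [hcd u hu, if_neg fun h' => hh (h.1 h')]⟩
  refine hQ d ((hfb.trans hfc).trans hfd) ?_ ?_ ?_
  · intro A h1 h2
    rw [had A h1, hac A h2, hab A h2]
  · intro u hu
    rcases hval u hu with ⟨-, h, v, hv, -, h'⟩ | ⟨-, h⟩
    · rw [h, ← h']
      exact hlt v hv
    · rw [h]
      exact hlt u hu
  · intro u hu v hv
    rcases hval u hu with ⟨hu1, hu2, hru⟩ | ⟨hu1, hu2⟩ <;>
      rcases hval v hv with ⟨hv1, hv2, hrv⟩ | ⟨hv1, hv2⟩ <;> rw [hu2, hv2]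
    · simp [hu1, hv1]
    · simp only [hv1, and_false, or_false]
      exact ⟨fun h => absurd (h ▸ hru) hv1, fun h => absurd (h ▸ hu1) hv1⟩
    · simp only [hu1, false_and, or_false]
      exact ⟨fun h => absurd (h ▸ hrv) hu1, fun h => absurd (h ▸ hv1) hu1⟩
    · simp [hu1]

end Merge

/-! ### Computing a premise-connected component of a block -/

section Components

variable {L : Lay} {a : AState} {Q : AState → Prop} {B : List (Implication (Fin L.n))}
  {X : Finset (Fin L.n)}

/-- The input of the layout is the list `B` of implications. -/
structure Represents (L : Lay) (B : List (Implication (Fin L.n))) : Prop where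
  length : B.length = L.m
  concl : ∀ i (h : i < B.length), L.concl i = B[i].2
  prem : ∀ i (h : i < B.length) (v : Fin L.n), L.prem i v ↔ v ∈ B[i].1

theorem Represents.inside_iff (hB : Represents L B) {f : ℕ → ℕ} {c : ℕ}
    (hX : ∀ v : Fin L.n, v ∈ X ↔ f v = c) {i : ℕ} (hi : i < B.length) :
    Inside L f c i ↔ B[i].1 ⊆ X ∧ B[i].2 ∈ X := by
  rw [Inside, hB.concl i hi, hX, and_comm]
  refine and_congr_left fun _ => ⟨fun h v hv => (hX v).2 (h v v.2 ((hB.prem i hi v).2 hv)), ?_⟩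
  intro h v hv hp
  exact (hX ⟨v, hv⟩).1 (h ((hB.prem i hi ⟨v, hv⟩).1 hp))

theorem Represents.hit_iff (hB : Represents L B) {f : ℕ → ℕ} {i x : ℕ} (hi : i < B.length) :
    Hit L f i x ↔ ∃ v ∈ B[i].1, f v = x := by
  constructor
  · rintro ⟨v, hv, hp, h⟩
    exact ⟨⟨v, hv⟩, (hB.prem i hi ⟨v, hv⟩).1 hp, h⟩
  · rintro ⟨v, hv, h⟩
    exact ⟨v, v.2, (hB.prem i hi v).2 hv, h⟩

/-- The number of elements of `X` that are smaller than `j`. -/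
def countBelow {n : ℕ} (X : Finset (Fin n)) (j : ℕ) : ℕ :=
  (X.filter fun v : Fin n => (v : ℕ) < j).card

@[simp] theorem countBelow_zero {n : ℕ} (X : Finset (Fin n)) : countBelow X 0 = 0 := by
  simp [countBelow]

theorem countBelow_self {n : ℕ} (X : Finset (Fin n)) : countBelow X n = X.card := by
  simp [countBelow]

theorem countBelow_le {n : ℕ} (X : Finset (Fin n)) (j : ℕ) : countBelow X j ≤ n :=
  (Finset.card_le_univ _).trans (by simp)

theorem countBelow_succ {n j : ℕ} (X : Finset (Fin n)) (hj : j < n) :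
    countBelow X (j + 1) = countBelow X j + if (⟨j, hj⟩ : Fin n) ∈ X then 1 else 0 := by
  unfold countBelow
  split_ifs with h
  · rw [← Finset.card_insert_of_notMem (a := (⟨j, hj⟩ : Fin n)) (by simp)]
    congr 1
    ext v
    simp only [Finset.mem_filter, Finset.mem_insert, Fin.ext_iff, Nat.lt_succ_iff_lt_or_eq]
    constructor
    · rintro ⟨h1, h2 | h2⟩
      · exact .inr ⟨h1, h2⟩
      · exact .inl h2
    · rintro (h1 | ⟨h1, h2⟩)
      · exact ⟨(Fin.ext h1 : v = ⟨j, hj⟩) ▸ h, .inr h1⟩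
      · exact ⟨h1, .inl h2⟩
  · rw [add_zero]
    congr 1
    ext v
    simp only [Finset.mem_filter, Nat.lt_succ_iff_lt_or_eq]
    refine and_congr_right fun hv => or_iff_left fun hvj => h ?_
    exact (Fin.ext hvj : v = ⟨j, hj⟩) ▸ hv

/-- Count the vertices of the current block, find one of them, and give every vertex a label of
its own. -/
def scan : Prog :=
  .const 14 0 ;; .const 15 0 ;; .op .sub 13 12 4 ;;
  forLoop 16 17 2 (wr .cmp 16 16 ;; rd .col 18 16 ;; .op .eq 18 18 13 ;;
    .cond 18 (.op .add 14 14 4 ;; .op .add 15 16 10) .skip)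

theorem Tr.scan {k : ℕ} (hs : Std L a) (hk : a.reg 12 = k + 1) (hkn : k ≤ L.n)
    (hX : ∀ v : Fin L.n, v ∈ X ↔ a.arr .col v = k)
    (hQ : ∀ b, Frame 13 a b → b.reg 13 = k → b.reg 14 = X.card →
      (X.Nonempty → ∃ v ∈ X, b.reg 15 = v) → (∀ A, A ≠ .cmp → b.arr A = a.arr A) →
      (∀ u < L.n, b.arr .cmp u = u) → Q b) :
    Tr L HDecomp.scan (L.n * 11 + 6) a Q := by
  obtain ⟨hdw, -, h2w⟩ := L.data_lt_word
  refine .const_seq (by omega) (.const_seq (by omega) ?_)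
  refine .op_seq (z := k) (by simp [BinOp.eval, hk, hs.one]) (by omega) ?_
  refine Tr.forLoop (N := L.n) (T := 8) (fun j b => Frame 13 a b ∧ b.reg 13 = k ∧
    b.reg 14 = countBelow X j ∧
    ((∃ v ∈ X, (v : ℕ) < j) → ∃ v ∈ X, b.reg 15 = v) ∧ (∀ A, A ≠ .cmp → b.arr A = a.arr A) ∧
    ∀ u < j, b.arr .cmp u = u)
    (by omega) (by omega) ?_ ?_ ?_ ?_ ?_
  · rintro j b ⟨hf, -⟩
    exact ⟨(hf 2 (by omega)).trans hs.vertices, (hf 4 (by omega)).trans hs.one⟩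
  · rintro j b x y ⟨hf, h⟩
    exact ⟨(hf.setReg (by omega)).setReg (by omega), by simpa using h⟩
  · refine ⟨((Frame.refl 13 a).setReg ?_ |>.setReg ?_ |>.setReg ?_), by simp, by simp, by simp,
      by simp, by simp⟩
    iterate 3 omega
  · rintro j hj b hb ⟨hf, h13, h14, h15, harr, hcmp⟩
    have hsb := hs.of_frame (hf.mono (l := 12) (by omega)) (by omega)
    refine .wr_seq hsb hb hj (by omega) ?_
    rw [hb]
    refine .rd_seq (i := j) ((hsb.setReg _ (by omega)).setArr _ _ _) (by simpa using hb) hj ?_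
    simp only [AState.setArr_arr, reduceCtorEq, false_and, if_false, AState.setReg_arr,
      harr .col (by simp)]
    refine .op_seq (z := if a.arr .col j = k then 1 else 0) (by simp [BinOp.eval, h13])
      (by split_ifs <;> omega) ?_
    have hcard := countBelow_succ X hj
    have hXj := hX ⟨j, hj⟩
    simp only at hXj
    have hcmp' : ∀ u < j + 1, (b.setArr .cmp j j).arr .cmp u = u := by
      intro u hu
      rw [AState.setArr_arr]
      by_cases h : u = j
      · simp [h]
      · simpa [h] using hcmp u (by omega)
    refine .cond (T := 2) ?_ ?_
    · intro hp
      have hjX : (⟨j, hj⟩ : Fin L.n) ∈ X := by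
        rw [hXj]
        by_contra h
        simp [h] at hp
      rw [if_pos hjX] at hcard
      have hlt := countBelow_le X (j + 1)
      refine .op_seq (z := countBelow X (j + 1))
        (by simp [BinOp.eval, hsb.one, h14, hcard]) (by omega) ?_
      -- Adding register 10, which is constantly zero, serves as a move between registers.
      refine .op (z := j) (by simp [BinOp.eval, hb, hsb.zero]) (by omega)
        ⟨by simpa using hb, ?_, by simpa using h13, by simp, ?_, ?_, ?_⟩
      · exact (hf.setReg (by omega)).setArr |>.setReg (by omega) |>.setReg (by omega)
          |>.setReg (by omega) |>.setReg (by omega)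
      · exact fun _ => ⟨_, hjX, by simp⟩
      · intro A hA
        simp only [AState.setReg_arr]
        rw [AState.setArr_arr_ne _ _ _ hA]
        exact harr A hA
      · exact hcmp'
    · intro hp
      have hjX : (⟨j, hj⟩ : Fin L.n) ∉ X := by
        rw [hXj]
        intro h
        simp [h] at hp
      rw [if_neg hjX, add_zero] at hcard
      refine Tr.mono (T₁ := 1) (.skip (Q := fun c => _) ⟨by simpa using hb, ?_,
        by simpa using h13, by simpa [hcard] using h14, ?_, ?_, ?_⟩) (by omega) (fun _ h => h)
      · exact (hf.setReg (by omega)).setArr |>.setReg (by omega) |>.setReg (by omega)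
      · rintro ⟨v, hv, hvj⟩
        rcases Nat.lt_succ_iff_lt_or_eq.1 hvj with h | h
        · simpa using h15 ⟨v, hv, h⟩
        · exact absurd ((Fin.ext h : v = ⟨j, hj⟩) ▸ hv) hjX
      · intro A hA
        simp only [AState.setReg_arr]
        rw [AState.setArr_arr_ne _ _ _ hA]
        exact harr A hA
      · exact hcmp'
  · rintro b ⟨hf, h13, h14, h15, harr, hcmp⟩
    rw [countBelow_self] at h14
    exact hQ b hf h13 h14 (fun ⟨v, hv⟩ => h15 ⟨v, hv, v.2⟩) harr hcmp

/-- Flag the implications inside the current block and label its premise-connected components. -/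
def findComponents : Prog :=
  forLoop 20 22 3 (.op .add 21 13 10 ;; checkInside ;; wr .flg 20 30 ;; .cond 30 mergePremise .skip)

/-- Tracks the sub-base of `X` seen so far when the loop over the list reads one more implication.
-/
theorem restrict_take_succ (X : Finset (Fin L.n)) {j : ℕ} (hj : j < B.length) :
    restrict (B.take (j + 1)).toFinset X = if B[j].1 ⊆ X ∧ B[j].2 ∈ X then
      insert B[j] (restrict (B.take j).toFinset X) else restrict (B.take j).toFinset X := by
  rw [List.take_succ_eq_append_getElem hj]
  split_ifs with h <;> ext p <;>
    simp only [mem_restrict, List.toFinset_append, Finset.mem_union, List.mem_toFinset,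
      List.mem_singleton, Finset.mem_insert]
  · constructor
    · rintro ⟨h1 | h1, h2⟩
      · exact .inr ⟨h1, h2⟩
      · exact .inl h1
    · rintro (rfl | ⟨h1, h2⟩)
      · exact ⟨.inr rfl, h⟩
      · exact ⟨.inl h1, h2⟩
  · constructor
    · rintro ⟨h1 | rfl, h2⟩
      · exact ⟨h1, h2⟩
      · exact absurd h2 h
    · exact fun ⟨h1, h2⟩ => ⟨.inl h1, h2⟩

/-- After `j` rounds two labels agree exactly when the vertices are connected by those of the first
`j` implications that lie inside `X`. The identity labelling is the case of the empty base
(`premiseConnected_empty`); a round either merges by `premiseConnected_insert` or leaves the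
sub-base unchanged. -/
theorem Tr.findComponents {k : ℕ} (hB : Represents L B) (hs : Std L a) (hk : a.reg 13 = k)
    (hkn : k ≤ L.n) (hX : ∀ v : Fin L.n, v ∈ X ↔ a.arr .col v = k)
    (hcmp : ∀ u < L.n, a.arr .cmp u = u)
    (hQ : ∀ b, Frame 20 a b → b.arr .col = a.arr .col → b.arr .out = a.arr .out →
      (∀ i < L.m, b.arr .flg i ≠ 0 ↔ Inside L (a.arr .col) k i) →
      (∀ u v : Fin L.n, b.arr .cmp u = b.arr .cmp v ↔
        PremiseConnected (restrict B.toFinset X) u v) → Q b) :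
    Tr L HDecomp.findComponents (L.m * (L.n * 35 + 27) + 3) a Q := by
  obtain ⟨hdw, -, h2w⟩ := L.data_lt_word
  refine Tr.forLoop (N := L.m) (T := L.n * 35 + 24) (fun j b => Frame 20 a b ∧
    b.arr .col = a.arr .col ∧ b.arr .out = a.arr .out ∧
    (∀ i < j, b.arr .flg i ≠ 0 ↔ Inside L (a.arr .col) k i) ∧ (∀ u < L.n, b.arr .cmp u < L.n) ∧
    (∀ u v : Fin L.n, b.arr .cmp u = b.arr .cmp v ↔
        PremiseConnected (restrict (B.take j).toFinset X) u v))
    (by omega) (by omega) ?_ ?_ ?_ ?_ ?_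
  · rintro j b ⟨hf, -⟩
    exact ⟨(hf 3 (by omega)).trans hs.implications, (hf 4 (by omega)).trans hs.one⟩
  · rintro j b x y ⟨hf, h⟩
    exact ⟨(hf.setReg (by omega)).setReg (by omega), by simpa using h⟩
  · refine ⟨.refl _ _, rfl, rfl, by simp, fun u hu => by rwa [hcmp u hu], fun u v => ?_⟩
    rw [hcmp _ u.2, hcmp _ v.2]
    simp [restrict, premiseConnected_empty, Fin.ext_iff]
  · rintro j hj b hb ⟨hf, hcol, hout, hflg, hlt, hconn⟩
    have hjB : j < B.length := hB.length ▸ hj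
    have hsb := hs.of_frame hf (by omega)
    refine .seq (T₁ := 1) (T₂ := L.n * 35 + 23) (.op (z := k)
      (by simp [BinOp.eval, hsb.zero, (hf 13 (by omega)).trans hk]) (by omega) ?_) (by omega)
    have hs1 := hsb.setReg (d := 21) k (by omega)
    refine .seq (T₁ := L.n * 10 + 9) (T₂ := L.n * 25 + 14)
      (.checkInside hs1 (by simpa using hb) hj ?_) (by omega)
    intro c hfc harr h30 hin
    simp only [AState.setReg_arr, AState.setReg_reg, if_true, hcol] at harr hin
    have hsc := hs1.of_frame hfc (by omega)
    have hc20 : c.reg 20 = j := (hfc _ (by omega)).trans (by simpa using hb)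
    refine .wr_seq hsc hc20 hj (by omega) ?_
    have hstep := restrict_take_succ X hjB
    have hins := hB.inside_iff hX hjB
    set d := (c.setReg 40 (L.base .flg + j)).setArr .flg j (c.reg 30) with hd
    have hsd : Std L d := (hsc.setReg _ (by omega)).setArr _ _ _
    have hfd : Frame 20 a d :=
      ((((hf.setReg (x := k) (d := 21) (by omega)).trans
        (hfc.mono (by omega))).setReg (by omega))).setArr
    have hd20 : d.reg 20 = j := by simpa [hd] using hc20
    have hd30 : d.reg 30 = c.reg 30 := by simp [hd]
    have hdarr : ∀ A, A ≠ .flg → d.arr A = b.arr A := by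
      intro A hA
      rw [hd, AState.setArr_arr_ne _ _ _ hA]
      exact congrFun harr A
    have hdflg : ∀ i < j + 1, d.arr .flg i ≠ 0 ↔ Inside L (a.arr .col) k i := by
      intro i hi
      rw [hd, AState.setArr_arr]
      by_cases h : i = j
      · simpa [h] using hin
      · simpa [h, harr] using hflg i (by omega)
    have hdcmp := hdarr .cmp (by simp)
    refine .cond (T := L.n * 25 + 11) ?_ ?_
    · intro hp
      rw [hd30, hin, hins] at hp
      rw [if_pos hp] at hstep
      refine .mergePremise hsd hd20 hj (by rwa [hdcmp]) fun e hfe harre hlte hconne =>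
        ⟨(hfe _ (by omega)).trans hd20, hfd.trans (hfe.mono (by omega)), ?_, ?_, ?_, hlte, ?_⟩
      · rw [harre .col (by simp) (by simp), hdarr .col (by simp), hcol]
      · rw [harre .out (by simp) (by simp), hdarr .out (by simp), hout]
      · rw [harre .flg (by simp) (by simp)]
        exact hdflg
      · intro u v
        rw [hconne u u.2 v v.2, hdcmp, hconn, hstep, premiseConnected_insert,
          hB.hit_iff hjB, hB.hit_iff hjB]
        simp only [hconn]
    · intro hp
      have hp' : ¬ (B[j].1 ⊆ X ∧ B[j].2 ∈ X) := by
        rw [← hins, ← hin, ← hd30]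
        exact fun h => h hp
      rw [if_neg hp'] at hstep
      refine Tr.mono (T₁ := 1) (.skip (Q := fun c => _) ⟨hd20, hfd, ?_, ?_, hdflg, ?_, ?_⟩)
        (by omega) (fun _ h => h)
      · rw [hdarr .col (by simp), hcol]
      · rw [hdarr .out (by simp), hout]
      · rwa [hdcmp]
      · intro u v
        rw [hdcmp, hstep, hconn]
  · rintro b ⟨hf, hcol, hout, hflg, -, hconn⟩
    refine hQ b hf hcol hout hflg fun u v => ?_
    rw [hconn, List.take_of_length_le hB.length.le]

/-- Count the vertices of the component of the vertex `R 15`. -/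
def countComponent : Prog :=
  rd .cmp 16 15 ;; .const 17 0 ;;
  forLoop 18 19 2 (rd .cmp 23 18 ;; .op .eq 23 23 16 ;; .op .add 17 17 23)

theorem Tr.countComponent {v₀ : Fin L.n} {C : Finset (Fin L.n)} (hs : Std L a)
    (hv : a.reg 15 = v₀) (hC : ∀ v : Fin L.n, v ∈ C ↔ a.arr .cmp v = a.arr .cmp v₀)
    (hQ : ∀ b, Frame 16 a b → b.arr = a.arr → b.reg 16 = a.arr .cmp v₀ → b.reg 17 = C.card →
      Q b) :
    Tr L HDecomp.countComponent (L.n * 7 + 6) a Q := by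
  obtain ⟨hdw, -, h2w⟩ := L.data_lt_word
  refine .rd_seq hs hv v₀.2 (.const_seq (by omega) ?_)
  refine Tr.forLoop (N := L.n) (T := 4) (fun j b => Frame 16 a b ∧ b.arr = a.arr ∧
    b.reg 16 = a.arr .cmp v₀ ∧ b.reg 17 = countBelow C j)
    (by omega) (by omega) ?_ ?_ ?_ ?_ ?_
  · rintro j b ⟨hf, -⟩
    exact ⟨(hf 2 (by omega)).trans hs.vertices, (hf 4 (by omega)).trans hs.one⟩
  · rintro j b x y ⟨hf, h⟩
    exact ⟨(hf.setReg (by omega)).setReg (by omega), by simpa using h⟩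
  · exact ⟨((Frame.refl _ _).setReg (by omega)).setReg (by omega), by simp, by simp, by simp⟩
  · rintro j hj b hb ⟨hf, harr, h16, h17⟩
    have hsb := hs.of_frame hf (by omega)
    have hcard := countBelow_succ C hj
    simp only [hC] at hcard
    have hlt := countBelow_le C (j + 1)
    refine .rd_seq hsb hb hj ?_
    refine .op_seq (z := if a.arr .cmp j = a.arr .cmp v₀ then 1 else 0)
      (by simp [BinOp.eval, harr, h16]) (by split_ifs <;> omega) ?_
    refine .op (z := countBelow C (j + 1))
      (by simp [BinOp.eval, h17, hcard]) (by omega) ⟨by simpa using hb, ?_, by simpa using harr,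
      by simpa using h16, by simp⟩
    exact (hf.setReg (by omega)).setReg (by omega) |>.setReg (by omega)
  · rintro b ⟨hf, harr, h16, h17⟩
    rw [countBelow_self] at h17
    exact hQ b hf harr h16 h17

end Components

/-! ### Splitting a block and writing the label of its node -/

section Split

variable {L : Lay} {a : AState} {Q : AState → Prop} {B : List (Implication (Fin L.n))}
  {X : Finset (Fin L.n)}

theorem Lay.cap_lt_word : L.cap < L.word := by
  have := L.space_eq
  have := L.space_le
  omega

/-- The word `w` is written from the address `o` on. -/
def WrittenAt (f : ℕ → ℕ) (o : ℕ) (w : List ℕ) : Prop := ∀ j (h : j < w.length), f (o + j) = w[j]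

theorem WrittenAt.congr {f g : ℕ → ℕ} {o : ℕ} {w : List ℕ} (h : WrittenAt f o w)
    (hg : ∀ j < w.length, g (o + j) = f (o + j)) : WrittenAt g o w :=
  fun j hj => (hg j hj).trans (h j hj)

theorem writtenAt_append {f : ℕ → ℕ} {o : ℕ} {w w' : List ℕ} :
    WrittenAt f o (w ++ w') ↔ WrittenAt f o w ∧ WrittenAt f (o + w.length) w' := by
  constructor
  · refine fun h => ⟨fun j hj => ?_, fun j hj => ?_⟩
    · rw [h j (by simp; omega), List.getElem_append_left hj]
    · rw [add_assoc, h (w.length + j) (by simpa using hj), List.getElem_append_right (by omega)]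
      simp
  · rintro ⟨h1, h2⟩ j hj
    rw [List.getElem_append]
    split_ifs with h
    · exact h1 j h
    · rw [← h2, add_assoc]
      congr
      omega

theorem writtenAt_cons {f : ℕ → ℕ} {o x : ℕ} {w : List ℕ} :
    WrittenAt f o (x :: w) ↔ f o = x ∧ WrittenAt f (o + 1) w := by
  rw [← List.singleton_append, writtenAt_append]
  simp [WrittenAt]

theorem writtenAt_nil {f : ℕ → ℕ} {o : ℕ} : WrittenAt f o [] := by
  simp [WrittenAt]

/-- Move the component with the label `R 16` to the block number `R 12`. -/
def recolor : Prog :=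
  forLoop 18 19 2 (rd .cmp 23 18 ;; .op .eq 23 23 16 ;; .cond 23 (wr .col 18 12) .skip)

theorem Tr.recolor (hs : Std L a)
    (hQ : ∀ b, Frame 18 a b → (∀ A, A ≠ .col → b.arr A = a.arr A) →
      (∀ u < L.n, b.arr .col u =
        if a.arr .cmp u = a.reg 16 then a.reg 12 else a.arr .col u) → Q b) :
    Tr L HDecomp.recolor (L.n * 9 + 3) a Q := by
  obtain ⟨hdw, -, h2w⟩ := L.data_lt_word
  refine Tr.forLoop (N := L.n) (T := 6) (fun j b => Frame 18 a b ∧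
    (∀ A, A ≠ .col → b.arr A = a.arr A) ∧ ∀ u < L.n, b.arr .col u =
      if u < j ∧ a.arr .cmp u = a.reg 16 then a.reg 12 else a.arr .col u)
    (by omega) (by omega) ?_ ?_ ⟨.refl _ _, fun _ _ => rfl, by simp⟩ ?_ ?_
  · rintro j b ⟨hf, -⟩
    exact ⟨(hf 2 (by omega)).trans hs.vertices, (hf 4 (by omega)).trans hs.one⟩
  · rintro j b x y ⟨hf, h⟩
    exact ⟨(hf.setReg (by omega)).setReg (by omega), by simpa using h⟩
  · rintro j hj b hb ⟨hf, harr, hcol⟩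
    have hsb := hs.of_frame hf (by omega)
    have h16 : b.reg 16 = a.reg 16 := hf _ (by omega)
    have h12 : b.reg 12 = a.reg 12 := hf _ (by omega)
    refine .rd_seq (i := j) hsb hb hj ?_
    simp only [harr .cmp (by simp)]
    refine .op_seq (z := if a.arr .cmp j = a.reg 16 then 1 else 0) (by simp [BinOp.eval, h16])
      (by split_ifs <;> omega) ?_
    have hfd : ∀ x y, Frame 18 a ((b.setReg 23 x).setReg 23 y) := fun x y =>
      (hf.setReg (by omega)).setReg (by omega)
    refine .cond (T := 2) ?_ ?_
    · intro hp
      have hp' : a.arr .cmp j = a.reg 16 := by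
        by_contra h
        simp [h] at hp
      refine .wr (i := j) (hs.of_frame (hfd _ _) (by omega)) (by simpa using hb) hj
        (by omega) ⟨by simpa using hb, ((hfd _ _).setReg (by omega)).setArr, ?_, ?_⟩
      · intro A hA
        rw [AState.setArr_arr_ne _ _ _ hA]
        exact harr A hA
      · intro u hu
        rw [AState.setArr_arr]
        by_cases h : u = j
        · subst h
          simp [hp', h12]
        · have e : u < j + 1 ↔ u < j := by omega
          simp [h, e, hcol u hu]
    · intro hp
      have hp' : a.arr .cmp j ≠ a.reg 16 := by
        intro h
        simp [h] at hp
      refine Tr.mono (T₁ := 1) (.skip (Q := fun c => _) ⟨by simpa using hb, hfd _ _,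
        by simpa using harr, ?_⟩) (by omega) (fun _ h => h)
      intro u hu
      simp only [AState.setReg_arr]
      by_cases h : u = j
      · subst h
        simp [hp', hcol u hu]
      · have e : u < j + 1 ↔ u < j := by omega
        simp [e, hcol u hu]
  · rintro b ⟨hf, harr, hcol⟩
    refine hQ b hf harr fun u hu => ?_
    rw [hcol u hu]
    simp [hu]

/-- Write the numbers of the flagged implications that lie inside neither of the blocks `R 13` and
`R 12`, leaving room for two words. -/
def collect : Prog :=
  .op .add 17 1 11 ;; forLoop 20 22 3 (rd .flg 23 20 ;; .cond 23
    (.op .add 21 13 10 ;; checkInside ;; .op .add 24 30 10 ;; .op .add 21 12 10 ;; checkInside ;;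
      .op .add 24 24 30 ;; .cond 24 .skip (wr .out 17 20 ;; .op .add 17 17 4)) .skip)

/-- The implication number `i` is flagged and inside neither of the blocks `c` and `d`. -/
def Crossing (L : Lay) (a : AState) (c d i : ℕ) : Prop :=
  a.arr .flg i ≠ 0 ∧ ¬ Inside L (a.arr .col) c i ∧ ¬ Inside L (a.arr .col) d i

/-- The flags are needed because recolouring has already erased the original block: they remember
which implications were inside it. `N` is separated from `L.m` so that the indices can be taken in
`Fin B.length`. -/
theorem Tr.collect {N o c d : ℕ} (hN : N = L.m) (hs : Std L a) (ho : a.reg 1 = o)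
    (hcap : o + 2 + L.m ≤ L.cap) (hc : a.reg 13 = c) (hd : a.reg 12 = d)
    (hcn : c ≤ L.n) (hdn : d ≤ L.n)
    (hQ : ∀ b, Frame 17 a b → (∀ A, A ≠ .out → b.arr A = a.arr A) →
      ∀ idx : List (Fin N), idx.Nodup → (∀ i, i ∈ idx ↔ Crossing L a c d i) →
      b.reg 17 = o + 2 + idx.length → idx.length ≤ L.m →
      (∀ x < o + 2, b.arr .out x = a.arr .out x) →
      WrittenAt (b.arr .out) (o + 2) (idx.map Fin.val) → Q b) :
    Tr L HDecomp.collect (L.m * (L.n * 20 + 32) + 4) a Q := by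
  obtain ⟨hdw, -, h2w⟩ := L.data_lt_word
  have hcw := L.cap_lt_word
  refine .op_seq (z := o + 2) (by simp [BinOp.eval, ho, hs.two]) (by omega) ?_
  refine Tr.forLoop (N := L.m) (T := L.n * 20 + 29) (fun j b => Frame 17 a b ∧
    (∀ A, A ≠ .out → b.arr A = a.arr A) ∧
    ∃ idx : List (Fin N), idx.Nodup ∧ (∀ i, i ∈ idx ↔ (i : ℕ) < j ∧ Crossing L a c d i) ∧
      b.reg 17 = o + 2 + idx.length ∧ idx.length ≤ j ∧
      (∀ x < o + 2, b.arr .out x = a.arr .out x) ∧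
      WrittenAt (b.arr .out) (o + 2) (idx.map Fin.val))
    (by omega) (by omega) ?_ ?_ ?_ ?_ ?_
  · rintro j b ⟨hf, -⟩
    exact ⟨(hf 3 (by omega)).trans hs.implications, (hf 4 (by omega)).trans hs.one⟩
  · rintro j b x y ⟨hf, h⟩
    exact ⟨(hf.setReg (by omega)).setReg (by omega), by simpa using h⟩
  · exact ⟨(Frame.refl _ _).setReg (by omega), fun _ _ => rfl, [], by simp, by simp, by simp,
      by simp, fun _ _ => rfl, writtenAt_nil⟩
  · rintro j hj b hb ⟨hf, harr, idx, hnd, hmem, h17, hlen, hout, hwr⟩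
    have hsb := hs.of_frame hf (by omega)
    have hskip : ¬ Crossing L a c d j → ∀ i : Fin N,
        i ∈ idx ↔ (i : ℕ) < j + 1 ∧ Crossing L a c d i := by
      intro hcr i
      rw [hmem, Nat.lt_succ_iff_lt_or_eq]
      constructor
      · exact fun h => ⟨.inl h.1, h.2⟩
      · rintro ⟨h | h, h'⟩
        · exact ⟨h, h'⟩
        · exact absurd (h ▸ h') hcr
    refine .seq (T₁ := 2) (T₂ := L.n * 20 + 27) (.rd hsb hb hj ?_) (by omega)
    rw [harr .flg (by simp)]
    refine .cond (T := L.n * 20 + 26) ?_ ?_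
    · intro hp
      simp only [AState.setReg_reg, if_true] at hp
      refine .seq (T₁ := 1) (T₂ := L.n * 20 + 25) (.op (z := c)
        (by simp [BinOp.eval, (hf 13 (by omega)).trans hc, hsb.zero]) (by omega) ?_) (by omega)
      refine .seq (T₁ := L.n * 10 + 9) (T₂ := L.n * 10 + 16) (.checkInside
        ((hsb.setReg _ (by omega)).setReg _ (by omega)) (by simpa using hb) hj ?_) (by omega)
      intro e hfe harre h30 hin
      simp only [AState.setReg_arr, AState.setReg_reg, if_true, harr .col (by simp)] at hin harre
      have hbe : ∀ r < 30, r ≠ 21 → r ≠ 23 → e.reg r = b.reg r := by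
        intro r h1 h2 h3
        rw [hfe r h1]
        simp [h2, h3]
      have hfe' : Frame 17 a e := fun r hr => (hbe r (by omega) (by omega) (by omega)).trans
        (hf r hr)
      have hse := hs.of_frame hfe' (by omega)
      refine .seq (T₁ := 1) (T₂ := L.n * 10 + 15) (.op (z := e.reg 30)
        (by simp [BinOp.eval, hse.zero]) (by omega) ?_) (by omega)
      refine .seq (T₁ := 1) (T₂ := L.n * 10 + 14) (.op (z := d)
        (by simp [BinOp.eval, (hfe' 12 (by omega)).trans hd, hse.zero]) (by omega) ?_) (by omega)
      refine .seq (T₁ := L.n * 10 + 9) (T₂ := 5) (.checkInside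
        ((hse.setReg _ (by omega)).setReg _ (by omega))
        (by simpa using (hbe 20 (by omega) (by omega) (by omega)).trans hb) hj ?_) (by omega)
      intro f hff harrf h30f hinf
      simp only [AState.setReg_arr, AState.setReg_reg, if_true, harre, harr .col (by simp)]
        at hinf harrf
      have hbf : ∀ r < 30, r ≠ 21 → r ≠ 23 → r ≠ 24 → f.reg r = b.reg r := by
        intro r h1 h2 h3 h4
        rw [hff r h1]
        simpa [h2, h4] using hbe r h1 h2 h3
      have h24 : f.reg 24 = e.reg 30 := by
        rw [hff 24 (by omega)]
        simp
      have hff' : Frame 17 a f := fun r hr =>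
        (hbf r (by omega) (by omega) (by omega) (by omega)).trans (hf r hr)
      have hsf := hs.of_frame hff' (by omega)
      -- The sum of the two tests vanishes exactly when the implication lies inside neither block.
      refine .op_seq (z := e.reg 30 + f.reg 30) (by simp [BinOp.eval, h24]) (by omega) ?_
      have hf20 : f.reg 20 = j := (hbf 20 (by omega) (by omega) (by omega) (by omega)).trans hb
      have hf17 : f.reg 17 = o + 2 + idx.length :=
        (hbf 17 (by omega) (by omega) (by omega) (by omega)).trans h17
      refine .cond (T := 3) ?_ ?_
      · intro hne
        simp only [AState.setReg_reg, if_true] at hne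
        have hcr : ¬ Crossing L a c d j := by
          rintro ⟨-, h1, h2⟩
          rw [← hin] at h1
          rw [← hinf] at h2
          omega
        refine Tr.mono (T₁ := 1) (.skip (Q := fun c => _) ⟨by simpa using hf20,
          hff'.setReg (by omega), ?_, idx, hnd, hskip hcr, by simpa using hf17, by omega, ?_, ?_⟩)
          (by omega) (fun _ h => h)
        · simpa [harrf] using harr
        · simpa [harrf] using hout
        · simpa [harrf] using hwr
      · intro heq
        simp only [AState.setReg_reg, if_true] at heq
        have hcr : Crossing L a c d j := by
          refine ⟨hp, ?_, ?_⟩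
          · rw [← hin]
            omega
          · rw [← hinf]
            omega
        refine .wr_seq (i := o + 2 + idx.length) (hsf.setReg _ (by omega)) (by simpa using hf17)
          (by change _ < L.cap; omega) (by omega) ?_
        refine .op (z := o + 2 + idx.length + 1) (by simp [BinOp.eval, hf17, hsf.one])
          (by omega) ⟨by simpa using hf20, ?_, ?_, idx ++ [⟨j, by omega⟩], ?_, ?_, ?_, ?_, ?_, ?_⟩
        · exact ((hff'.setReg (by omega)).setReg (by omega)).setArr.setReg (by omega)
        · intro A hA
          simp only [AState.setReg_arr]
          rw [AState.setArr_arr_ne _ _ _ hA]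
          simpa [harrf] using harr A hA
        · rw [List.nodup_append]
          refine ⟨hnd, by simp, ?_⟩
          rintro x hx y hy rfl
          simp only [List.mem_singleton] at hy
          subst hy
          simpa using ((hmem _).1 hx).1
        · intro i
          simp only [List.mem_append, hmem, List.mem_singleton, Fin.ext_iff]
          rw [Nat.lt_succ_iff_lt_or_eq]
          constructor
          · rintro (h | h)
            · exact ⟨.inl h.1, h.2⟩
            · exact ⟨.inr h, h ▸ hcr⟩
          · rintro ⟨h | h, h'⟩
            · exact .inl ⟨h, h'⟩
            · exact .inr h
        · simp
          omega
        · simp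
          omega
        · intro x hx
          simp only [AState.setReg_arr]
          rw [AState.setArr_arr, if_neg (by omega)]
          simpa [harrf] using hout x hx
        · rw [List.map_append, writtenAt_append]
          constructor
          · refine hwr.congr fun x hx => ?_
            simp only [List.length_map] at hx
            simp only [AState.setReg_arr]
            rw [AState.setArr_arr, if_neg (by omega)]
            simp [harrf]
          · simp only [List.map_cons, List.map_nil, writtenAt_cons, writtenAt_nil, and_true,
              AState.setReg_arr, List.length_map]
            rw [AState.setArr_arr, if_pos ⟨rfl, rfl⟩]
            simpa using hf20
    · intro hp
      simp only [AState.setReg_reg, if_true] at hp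
      have hcr : ¬ Crossing L a c d j := fun h => h.1 hp
      exact Tr.mono (T₁ := 1) (.skip (Q := fun c => _) ⟨by simpa using hb,
        hf.setReg (by omega), harr, idx, hnd, hskip hcr, by simpa using h17, by omega, hout, hwr⟩)
        (by omega) (fun _ h => h)
  · rintro b ⟨hf, harr, idx, hnd, hmem, h17, hlen, hout, hwr⟩
    refine hQ b hf harr idx hnd (fun i => ?_) h17 hlen hout hwr
    rw [hmem]
    simp only [and_iff_right_iff_imp]
    omega

/-- Complete the word of an interior node and activate the new block. -/
def finishNode : Prog :=
  wr .out 1 4 ;; .op .sub 18 17 1 ;; .op .sub 18 18 11 ;; .op .add 19 1 4 ;; wr .out 19 18 ;;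
    .op .add 1 17 10 ;; .op .add 12 12 4

/-- The tag and the length of the label fill the two words left free before the indices. The length
is recovered as the difference of the write positions minus 2. -/
theorem Tr.finishNode {o l k : ℕ} {w : List ℕ} (hs : Std L a) (ho : a.reg 1 = o)
    (h17 : a.reg 17 = o + 2 + l) (hcap : o + 2 + l ≤ L.cap) (hl : w.length = l)
    (hk : a.reg 12 = k) (hkn : k ≤ L.n) (hw : WrittenAt (a.arr .out) (o + 2) w)
    (hQ : ∀ b, Std L b → b.reg 12 = k + 1 → b.reg 1 = o + 2 + l →
      (∀ A, A ≠ .out → b.arr A = a.arr A) → (∀ x < o, b.arr .out x = a.arr .out x) →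
      WrittenAt (b.arr .out) o (1 :: l :: w) → Q b) :
    Tr L HDecomp.finishNode 9 a Q := by
  obtain ⟨hdw, hd2, h2w⟩ := L.data_lt_word
  have hcw := L.cap_lt_word
  refine .wr_seq (i := o) hs ho (by change o < L.cap; omega) (by omega) ?_
  rw [hs.one]
  have hs1 := (hs.setReg (d := 40) (L.base .out + o) (by omega)).setArr .out o 1
  refine .op_seq (z := 2 + l) (by simp [BinOp.eval, h17, ho]; omega) (by omega) ?_
  have hs2 := hs1.setReg (d := 18) (2 + l) (by omega)
  refine .op_seq (z := l) (by simp [BinOp.eval, hs.two]) (by omega) ?_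
  refine .op_seq (z := o + 1) (by simp [BinOp.eval, ho, hs.one]) (by omega) ?_
  have hs3 := (hs2.setReg (d := 18) l (by omega)).setReg (d := 19) (o + 1) (by omega)
  refine .wr_seq (i := o + 1) hs3 (by simp) (by change _ < L.cap; omega) (by omega) ?_
  have hs4 := (hs3.setReg (d := 40) (L.base .out + (o + 1)) (by omega)).setArr .out (o + 1) l
  refine .op_seq (z := o + 2 + l) (by simp [BinOp.eval, h17, hs.zero]) (by omega) ?_
  refine .op (z := k + 1) (by simp [BinOp.eval, hk, hs.one]) (by omega) ?_
  refine hQ _ ?_ (by simp) (by simp) ?_ ?_ ?_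
  · simpa using (hs4.setReg (d := 1) (o + 2 + l) (by omega)).setReg (d := 12) (k + 1) (by omega)
  · intro A hA
    simp [AState.setArr_arr_ne _ _ _ hA]
  · intro x hx
    simp only [AState.setReg_arr]
    rw [AState.setArr_arr, if_neg (by omega)]
    simp only [AState.setReg_arr]
    rw [AState.setArr_arr, if_neg (by omega)]
    simp
  · rw [writtenAt_cons, writtenAt_cons]
    refine ⟨?_, ?_, hw.congr fun x hx => ?_⟩
    · simp [AState.setArr_arr]
    · simp [AState.setArr_arr]
    · have h1 : ¬ (o + 1 + 1 + x = o + 1) := by omega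
      have h2 : ¬ (o + 1 + 1 + x = o) := by omega
      simp [AState.setArr_arr, h1, h2]

end Split

/-! ### One call of the algorithm as one iteration of the loop -/

section Step

variable {L : Lay} {a : AState} {Q : AState → Prop} {B : List (Implication (Fin L.n))}
  {X : Finset (Fin L.n)}

/-- In the constructor the coercion of the indices elaborates to a monadic lift of the list followed
by an identity map; this version uses `Fin.val` instead. -/
theorem encodesTree_node {n : ℕ} {B : List (Implication (Fin n))} {idx : List (Fin B.length)}
    (hidx : idx.Nodup) {l r : LTree (Fin n)} {wl wr : List ℕ} (hl : EncodesTree B l wl)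
    (hr : EncodesTree B r wr) :
    EncodesTree B (.node (idx.map B.get).toFinset l r)
      (1 :: idx.length :: (idx.map Fin.val ++ wl ++ wr)) := by
  have e : (List.map (fun i : ℕ => i) (do let a ← idx; pure (a : ℕ))) = idx.map Fin.val := by
    simpa using List.map_eq_flatMap.symm
  have := EncodesTree.node idx hidx hl hr
  rwa [e] at this

/-- The situation at the start of an iteration of the main loop: the block number `k`, which is to
be processed next, is `X`, and the output so far is `w`. -/
structure Ready (L : Lay) (X : Finset (Fin L.n)) (k : ℕ) (w : List ℕ) (a : AState) : Prop where
  std : Std L a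
  blocks : a.reg 12 = k + 1
  mem_block : ∀ v : Fin L.n, v ∈ X ↔ a.arr .col v = k
  block_le : ∀ v : Fin L.n, a.arr .col v ≤ k ∨ a.arr .col v = L.n
  length : a.reg 1 = w.length
  written : WrittenAt (a.arr .out) 0 w

/-- Write a leaf and finish the current block. -/
def leafBlock : Prog :=
  wr .out 1 10 ;; .op .add 1 1 4 ;; wr .out 1 15 ;; .op .add 1 1 4 ;; wr .col 15 2 ;;
    .op .add 12 13 10

/-- Giving the vertex the number `n` retires it, and copying `k` into register 12 removes its block
from the pending ones. -/
theorem Tr.leafBlock {k : ℕ} {v : Fin L.n} {w : List ℕ} (hs : Std L a) (hl : a.reg 1 = w.length)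
    (hv : a.reg 15 = v) (hk : a.reg 13 = k) (hkn : k ≤ L.n) (hcap : w.length + 2 ≤ L.cap)
    (hw : WrittenAt (a.arr .out) 0 w)
    (hQ : ∀ b, Std L b → b.reg 12 = k → b.reg 1 = (w ++ [0, (v : ℕ)]).length →
      WrittenAt (b.arr .out) 0 (w ++ [0, (v : ℕ)]) →
      (∀ u : Fin L.n, b.arr .col u = if u = v then L.n else a.arr .col u) → Q b) :
    Tr L HDecomp.leafBlock 9 a Q := by
  obtain ⟨hdw, hd2, h2w⟩ := L.data_lt_word
  have hcw := L.cap_lt_word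
  refine .wr_seq hs hl (by change _ < L.cap; omega) (by omega) ?_
  rw [hs.zero]
  have hs1 := (hs.setReg (d := 40) (L.base .out + w.length) (by omega)).setArr .out w.length 0
  refine .op_seq (z := w.length + 1) (by simp [BinOp.eval, hl, hs.one]) (by omega) ?_
  have hs2 := hs1.setReg (d := 1) (w.length + 1) (by omega)
  refine .wr_seq (i := w.length + 1) hs2 (by simp) (by change _ < L.cap; omega) (by omega) ?_
  have hs3 := (hs2.setReg (d := 40) (L.base .out + (w.length + 1)) (by omega)).setArr .out
    (w.length + 1) v
  refine .op_seq (z := w.length + 2) (by simp [BinOp.eval, hs.one]) (by omega) ?_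
  have hs4 := hs3.setReg (d := 1) (w.length + 2) (by omega)
  refine .wr_seq (i := v) ?_ (by simpa using hv) v.2 (by omega) ?_
  · simpa [hv] using hs4
  refine .op (z := k) (by simp [BinOp.eval, hk, hs.zero]) (by omega) ?_
  have hs5 := ((hs4.setReg (d := 40) (L.base .col + v) (by omega)).setArr .col v L.n).setReg
    (d := 12) k (by omega)
  refine hQ _ ?_ (by simp) (by simp) ?_ ?_
  · simpa [hv, hs.vertices] using hs5
  · simp only [writtenAt_append, writtenAt_cons, writtenAt_nil, and_true, zero_add]
    refine ⟨hw.congr fun x hx => ?_, ?_, ?_⟩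
    · have h1 : x ≠ w.length + 1 := by omega
      have h2 : x ≠ w.length := by omega
      simp [AState.setArr_arr, h1, h2]
    · simp [AState.setArr_arr]
    · simp [AState.setArr_arr, hv]
  · intro u
    simp [AState.setArr_arr, hs.vertices, Fin.ext_iff]

/-- Replace the output by `FAIL` and discard all blocks. -/
def failBlock : Prog := wr .out 10 10 ;; .op .add 1 4 10 ;; .op .add 12 10 10

/-- The partial output is abandoned by resetting its length to 1; zero pending blocks end the main
loop at its next test. -/
theorem Tr.failBlock (hs : Std L a)
    (hQ : ∀ b, b.reg 0 = L.base .out → b.reg 12 = 0 → b.reg 1 = 1 → b.arr .out 0 = 0 → Q b) :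
    Tr L HDecomp.failBlock 4 a Q := by
  obtain ⟨hdw, hd2, h2w⟩ := L.data_lt_word
  refine .wr_seq hs hs.zero L.one_le_cap (by omega) ?_
  refine .op_seq (z := 1) (by simp [BinOp.eval, hs.one, hs.zero]) (by omega) ?_
  refine .op (z := 0) (by simp [BinOp.eval, hs.zero]) (by omega) ?_
  exact hQ _ (by simpa [breg] using hs.base .out) (by simp) (by simp) (by simp [AState.setArr_arr, hs.zero])

/-- One iteration of the main loop, that is, one call of the algorithm. -/
def processBlock : Prog :=
  scan ;; .op .eq 18 14 4 ;; .cond 18 leafBlock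
    (findComponents ;; countComponent ;; .op .eq 18 17 14 ;; .cond 18 failBlock
      (recolor ;; collect ;; finishNode))

/-- A bound for the running time of one iteration. -/
def Lay.stepTime (L : Lay) : ℕ := L.m * (L.n * 55 + 59) + L.n * 27 + 40

/-- The continuations correspond to a leaf, an immediate `FAIL` and a split. In the last case the
final equation for the block numbers lets the caller recover `X \ C` once `C` is finished. -/
theorem Tr.processBlock {k : ℕ} {w : List ℕ} (hB : Represents L B) (ha : Ready L X k w a)
    (hX : X.Nonempty) (hk : k + X.card ≤ L.n) (hcap : w.length + 2 + L.m ≤ L.cap)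
    (hleaf : ∀ b v, X = {v} → Std L b → b.reg 12 = k →
      b.reg 1 = (w ++ [0, (v : ℕ)]).length → WrittenAt (b.arr .out) 0 (w ++ [0, (v : ℕ)]) →
      (∀ u : Fin L.n, b.arr .col u = if u = v then L.n else a.arr .col u) → Q b)
    (hfail : ∀ b C, 2 ≤ X.card → IsPremiseComponent X (restrict B.toFinset X) C →
      C.card = X.card → b.reg 0 = L.base .out → b.reg 12 = 0 → b.reg 1 = 1 →
      b.arr .out 0 = 0 → Q b)
    (hsplit : ∀ b C, ∀ idx : List (Fin B.length), 2 ≤ X.card →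
      IsPremiseComponent X (restrict B.toFinset X) C → C.card ≠ X.card → idx.Nodup →
      (idx.map B.get).toFinset = restrict B.toFinset X \
        (restrict B.toFinset C ∪ restrict B.toFinset (X \ C)) → idx.length ≤ L.m →
      Ready L C (k + 1) (w ++ 1 :: idx.length :: idx.map Fin.val) b →
      (∀ u : Fin L.n, b.arr .col u = if u ∈ C then k + 1 else a.arr .col u) → Q b) :
    Tr L HDecomp.processBlock L.stepTime a Q := by
  obtain ⟨hdw, hd2, h2w⟩ := L.data_lt_word
  have hXpos := Finset.card_pos.2 hX
  have hXn : X.card ≤ L.n := (Finset.card_le_univ _).trans (by simp)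
  have e1 : L.m * (L.n * 55 + 59) = L.m * (L.n * 35 + 27) + L.m * (L.n * 20 + 32) := by ring
  unfold Lay.stepTime
  refine .seq (T₁ := L.n * 11 + 6) (T₂ := L.m * (L.n * 55 + 59) + L.n * 16 + 34)
    (.scan (X := X) ha.std ha.blocks (by omega) ha.mem_block ?_) (by omega)
  intro b hfb h13 h14 h15 hab hcmp
  obtain ⟨v, hvX, h15⟩ := h15 hX
  have hsb := ha.std.of_frame hfb (by omega)
  have hb1 : b.reg 1 = w.length := (hfb 1 (by omega)).trans ha.length
  have hbcol := hab .col (by simp)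
  have hbout := hab .out (by simp)
  refine .seq (T₁ := 1) (T₂ := L.m * (L.n * 55 + 59) + L.n * 16 + 33)
    (.op (z := if X.card = 1 then 1 else 0) (by simp [BinOp.eval, h14, hsb.one])
      (by split_ifs <;> omega) ?_) (by omega)
  have hsb' := hsb.setReg (d := 18) (if X.card = 1 then 1 else 0) (by omega)
  refine Tr.cond (T := L.m * (L.n * 55 + 59) + L.n * 16 + 32) ?_ ?_
  · intro h
    have hX1 : X.card = 1 := by
      by_contra hne
      simp [hne] at h
    obtain ⟨u, rfl⟩ := Finset.card_eq_one.1 hX1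
    obtain rfl := Finset.mem_singleton.1 hvX
    refine Tr.mono (T₁ := 9) (.leafBlock hsb' (by simpa using hb1) (by simpa using h15)
      (by simpa using h13) (by omega) (by omega) (by simpa [hbout] using ha.written) ?_)
      (by omega) (fun _ h => h)
    intro c hsc h12 h1 hwr hcol
    refine hleaf c v rfl hsc h12 h1 hwr fun u => ?_
    rw [hcol]
    simp [hbcol]
  · intro h
    have hX1 : X.card ≠ 1 := by
      intro he
      simp [he] at h
    have hX2 : 2 ≤ X.card := by omega
    refine .seq (T₁ := L.m * (L.n * 35 + 27) + 3) (T₂ := L.m * (L.n * 20 + 32) + L.n * 16 + 29)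
      (.findComponents (k := k) (X := X) hB hsb' (by simpa using h13) (by omega)
        (by simpa [hbcol] using ha.mem_block) (by simpa using hcmp) ?_) (by omega)
    intro c hfc hccol hcout hflg hconn
    simp only [AState.setReg_arr, hbcol, hbout] at hccol hcout hflg
    have hsc := hsb'.of_frame hfc (by omega)
    have hbc : ∀ r < 20, r ≠ 18 → c.reg r = b.reg r := by
      intro r h1 h2
      rw [hfc r h1]
      simp [h2]
    set C : Finset (Fin L.n) := Finset.univ.filter fun u => c.arr .cmp u = c.arr .cmp v with hCdef
    have hCmem : ∀ u : Fin L.n, u ∈ C ↔ c.arr .cmp u = c.arr .cmp v := by simp [hCdef]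
    have hCconn : ∀ u, u ∈ C ↔ u ∈ X ∧ PremiseConnected (restrict B.toFinset X) v u := by
      intro u
      rw [hCmem, eq_comm, hconn]
      refine ⟨fun h => ⟨?_, h⟩, fun h => h.2⟩
      -- All vertices are labelled, but the premises used lie inside `X`, so the class of `v` does
      -- not leave `X`.
      exact mem_of_premiseConnected (P := fun x => x ∈ X)
        (fun p hp x _ y hy _ => (mem_restrict.1 hp).2.1 hy) h hvX
    have hC := isPremiseComponent_of_mem hvX hCconn
    refine .seq (T₁ := L.n * 7 + 6) (T₂ := L.m * (L.n * 20 + 32) + L.n * 9 + 22)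
      (.countComponent hsc ((hbc 15 (by omega) (by omega)).trans h15) hCmem ?_) (by omega)
    intro d hfd hdarr h16 h17
    have hsd := hsc.of_frame hfd (by omega)
    have hbd : ∀ r < 16, d.reg r = b.reg r := fun r hr =>
      (hfd r hr).trans (hbc r (by omega) (by omega))
    have hCX := Finset.card_le_card hC.subset
    refine .seq (T₁ := 1) (T₂ := L.m * (L.n * 20 + 32) + L.n * 9 + 20)
      (.op (z := if C.card = X.card then 1 else 0)
        (by simp [BinOp.eval, h17, (hbd 14 (by omega)).trans h14])
        (by split_ifs <;> omega) ?_) (by omega)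
    have hsd' := hsd.setReg (d := 18) (if C.card = X.card then 1 else 0) (by omega)
    refine Tr.cond (T := L.m * (L.n * 20 + 32) + L.n * 9 + 19) ?_ ?_
    · intro h
      have hcard : C.card = X.card := by
        by_contra hne
        simp [hne] at h
      exact Tr.mono (T₁ := 4) (.failBlock hsd' fun e => hfail e C hX2 hC hcard)
        (by omega) (fun _ h => h)
    · intro h
      have hcard : C.card ≠ X.card := by
        intro he
        simp [he] at h
      refine .seq (T₁ := L.n * 9 + 3) (T₂ := L.m * (L.n * 20 + 32) + 13) (.recolor hsd' ?_)
        (by omega)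
      intro e hfe hearr hecol
      have hse := hsd'.of_frame hfe (by omega)
      have h12d : d.reg 12 = k + 1 :=
        (hbd 12 (by omega)).trans ((hfb 12 (by omega)).trans ha.blocks)
      have hde : ∀ r < 18, e.reg r = d.reg r := by
        intro r h1
        rw [hfe r h1]
        simp [show r ≠ 18 by omega]
      have hecol' : ∀ u : Fin L.n,
          e.arr .col u = if u ∈ C then k + 1 else a.arr .col u := by
        intro u
        rw [hecol u u.2]
        simp [hdarr, h16, h12d, hCmem, hccol]
      have heout : e.arr .out = a.arr .out := by
        rw [hearr .out (by simp)]
        simpa [hdarr] using hcout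
      have heflg : e.arr .flg = c.arr .flg := by
        rw [hearr .flg (by simp)]
        simp [hdarr]
      have he1 : e.reg 1 = w.length := by rw [hde 1 (by omega), hbd 1 (by omega), hb1]
      -- The number `k + 1` is fresh: pending vertices have numbers at most `k`, and `k + X.card ≤
      -- n` with `2 ≤ X.card` gives `k + 1 < n`, so it is not the mark of finished vertices.
      have heC : ∀ u : Fin L.n, u ∈ C ↔ e.arr .col u = k + 1 := by
        intro u
        rw [hecol']
        split_ifs with hu
        · simp [hu]
        · rcases ha.block_le u with h | h
          · simp only [hu, false_iff]
            omega
          · simp only [hu, false_iff]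
            omega
      have heXC : ∀ u : Fin L.n, u ∈ X \ C ↔ e.arr .col u = k := by
        intro u
        rw [hecol', Finset.mem_sdiff, ha.mem_block]
        split_ifs with hu
        · simp [hu]
        · simp [hu]
      refine .seq (T₁ := L.m * (L.n * 20 + 32) + 4) (T₂ := 9) (.collect (o := w.length) (c := k)
        (d := k + 1) hB.length hse he1 (by omega)
        (by rw [hde 13 (by omega), hbd 13 (by omega), h13])
        (by rw [hde 12 (by omega), h12d]) (by omega) (by omega) ?_) (by omega)
      intro f hff hfarr idx hnd hmem h17f hlen hfout hfwr
      have hsf := hse.of_frame hff (by omega)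
      refine .finishNode (o := w.length) (l := idx.length) (k := k + 1) (w := idx.map Fin.val) hsf
        ((hff 1 (by omega)).trans he1) h17f (by omega) (by simp)
        (by rw [hff 12 (by omega), hde 12 (by omega), h12d]) (by omega) hfwr ?_
      intro g hsg h12g h1g hgarr hgout hgwr
      have hgcol : g.arr .col = e.arr .col :=
        (hgarr .col (by simp)).trans (hfarr .col (by simp))
      refine hsplit g C idx hX2 hC hcard hnd ?_ hlen ⟨hsg, h12g, ?_, ?_, ?_, ?_⟩ ?_
      · ext p
        simp only [List.mem_toFinset, List.mem_map, hmem, Finset.mem_sdiff, Finset.mem_union,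
          mem_restrict, Crossing, heflg]
        have key : ∀ i : Fin B.length, (c.arr .flg i ≠ 0 ∧ ¬ Inside L (e.arr .col) k i ∧
            ¬ Inside L (e.arr .col) (k + 1) i) ↔ (((B.get i).1 ⊆ X ∧ (B.get i).2 ∈ X) ∧
            ¬ ((B.get i).1 ⊆ X \ C ∧ (B.get i).2 ∈ X \ C) ∧
            ¬ ((B.get i).1 ⊆ C ∧ (B.get i).2 ∈ C)) := by
          intro i
          rw [hflg i (hB.length ▸ i.2), hB.inside_iff ha.mem_block i.2, hB.inside_iff heXC i.2,
            hB.inside_iff heC i.2]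
          rfl
        constructor
        · rintro ⟨i, hi, rfl⟩
          have := (key i).1 hi
          have hiB : B.get i ∈ B := List.get_mem _ _
          simp only [Finset.mem_sdiff] at this ⊢
          tauto
        · rintro ⟨⟨hp, h1⟩, h2⟩
          obtain ⟨i, rfl⟩ := List.get_of_mem hp
          refine ⟨i, (key i).2 ⟨h1, ?_, ?_⟩, rfl⟩
          · exact fun h => h2 (.inr ⟨hp, h.1, Finset.mem_sdiff.1 h.2⟩)
          · exact fun h => h2 (.inl ⟨hp, h⟩)
      · rw [hgcol]
        exact heC
      · intro u
        rw [hgcol, hecol']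
        split_ifs
        · exact .inl le_rfl
        · exact (ha.block_le u).imp (fun h => h.trans (Nat.le_succ k)) id
      · rw [h1g]
        simp
        omega
      · rw [writtenAt_append, zero_add]
        refine ⟨ha.written.congr fun x hx => ?_, hgwr⟩
        rw [zero_add, hgout x hx, hfout x (by omega), heout]
      · intro u
        rw [hgcol, hecol']

end Step

/-! ### The main loop, its running time and the length of its output -/

section Main

variable {L : Lay} {B : List (Implication (Fin L.n))}

def mainLoop : Prog := .loop 12 processBlock

/-- The final configuration of a failing run. -/
structure Failed (L : Lay) (b : AState) : Prop where
  address : b.reg 0 = L.base .out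
  length : b.reg 1 = 1
  word : b.arr .out 0 = 0

/-- Processing the block with the largest number either ends the run with `FAIL`, or it appends the
word of a tree of this block to the output and removes the block. -/
theorem exec_block (hB : Represents L B) (N : ℕ) :
    ∀ (X : Finset (Fin L.n)) (k : ℕ) (w : List ℕ) (a : AState), X.card = N → X.Nonempty →
      Ready L X k w a → k + X.card ≤ L.n → w.length + (L.m + 4) * X.card ≤ L.cap →
      (∃ b t, Exec L.space L.word mainLoop (L.conc a) (L.conc b) t ∧
        t ≤ 2 * X.card * (L.stepTime + 1) + 1 ∧
        BuildTree X (restrict B.toFinset X) .fail ∧ Failed L b) ∨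
      (∃ b t T wT, BuildTree X (restrict B.toFinset X) (.ok (some T)) ∧ EncodesTree B T wT ∧
        wT.length + (L.m + 2) ≤ (L.m + 4) * X.card ∧
        t + (L.stepTime + 1) ≤ 2 * X.card * (L.stepTime + 1) ∧
        Std L b ∧ b.reg 12 = k ∧ b.reg 1 = (w ++ wT).length ∧
        WrittenAt (b.arr .out) 0 (w ++ wT) ∧
        (∀ u : Fin L.n, b.arr .col u = if u ∈ X then L.n else a.arr .col u) ∧
        ∀ s' t', Exec L.space L.word mainLoop (L.conc b) s' t' →
          Exec L.space L.word mainLoop (L.conc a) s' (t + t')) := by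
  -- The bounds count the nodes of a full binary tree with `X.card` leaves. Leaves take 2 words and
  -- the `X.card - 1` interior nodes at most `L.m + 2` each, which adds up to `(L.m + 4) * X.card -
  -- (L.m + 2)`; the `2 * X.card - 1` iterations take at most `L.stepTime + 1` steps each. Since the
  -- loop does not halt after a block, success is expressed as the ability to prefix any further
  -- execution of the loop.
  induction N using Nat.strong_induction_on with
  | _ N ih =>
  intro X k w a hN hX ha hk hcap
  subst hN
  have hXpos := Finset.card_pos.2 hX
  have hmul1 : L.m + 4 ≤ (L.m + 4) * X.card := Nat.le_mul_of_pos_right _ hXpos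
  have ha12 : (L.conc a).reg 12 ≠ 0 := by
    change a.reg 12 ≠ 0
    rw [ha.blocks]
    omega
  set T := L.stepTime with hT
  have hmulT : T + 1 ≤ X.card * (T + 1) := Nat.le_mul_of_pos_left _ hXpos
  obtain ⟨b, t, hex, ht, hQ⟩ := Tr.processBlock (Q := fun b =>
    (∃ v, X = {v} ∧ Std L b ∧ b.reg 12 = k ∧ b.reg 1 = (w ++ [0, (v : ℕ)]).length ∧
      WrittenAt (b.arr .out) 0 (w ++ [0, (v : ℕ)]) ∧
      ∀ u : Fin L.n, b.arr .col u = if u = v then L.n else a.arr .col u) ∨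
    (∃ C, 2 ≤ X.card ∧ IsPremiseComponent X (restrict B.toFinset X) C ∧ C.card = X.card ∧
      b.reg 12 = 0 ∧ Failed L b) ∨
    (∃ C, ∃ idx : List (Fin B.length), 2 ≤ X.card ∧
      IsPremiseComponent X (restrict B.toFinset X) C ∧ C.card ≠ X.card ∧ idx.Nodup ∧
      (idx.map B.get).toFinset = restrict B.toFinset X \
        (restrict B.toFinset C ∪ restrict B.toFinset (X \ C)) ∧ idx.length ≤ L.m ∧
      Ready L C (k + 1) (w ++ 1 :: idx.length :: idx.map Fin.val) b ∧
      ∀ u : Fin L.n, b.arr .col u = if u ∈ C then k + 1 else a.arr .col u))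
    hB ha hX hk (by omega)
    (fun b v h1 h2 h3 h4 h5 h6 => .inl ⟨v, h1, h2, h3, h4, h5, h6⟩)
    (fun b C h1 h2 h3 h4 h5 h6 h7 => .inr (.inl ⟨C, h1, h2, h3, h5, h4, h6, h7⟩))
    (fun b C idx h1 h2 h3 h4 h5 h6 h7 h8 =>
      .inr (.inr ⟨C, idx, h1, h2, h3, h4, h5, h6, h7, h8⟩))
  have hmul2 : 2 * X.card * (T + 1) = X.card * (T + 1) + X.card * (T + 1) := by ring
  rcases hQ with ⟨v, rfl, hsb, h12, h1, hwr, hcol⟩ | ⟨C, hX2, hC, hcard, h12, hF⟩ |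
    ⟨C, idx, hX2, hC, hcard, hnd, hidx, hlen, hb, hcol⟩
  · refine .inr ⟨b, t + 1, .leaf v, [0, (v : ℕ)], .single v _, .leaf v, ?_, ?_, hsb, h12, h1, hwr,
      by simpa using hcol, ?_⟩
    · simp
      omega
    · simp only [Finset.card_singleton] at *
      omega
    · intro s' t' h
      have := Exec.loopStep ha12 hex h
      rwa [add_right_comm] at this
  · refine .inl ⟨b, t + 1 + 1, .loopStep ha12 hex (.loopDone h12), ?_, ?_, hF⟩
    · omega
    · exact .halt X _ C hX2 hC hcard
  · have hClt := card_component_lt hC.subset hcard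
    have hCne := hC.nonempty hX
    have hCpos := Finset.card_pos.2 hCne
    have hsd := Finset.card_sdiff_of_subset hC.subset
    have hDne : (X \ C).Nonempty := Finset.card_pos.1 (by omega)
    have hsum : X.card = C.card + (X \ C).card := by omega
    have hmulC : (L.m + 4) * X.card = (L.m + 4) * C.card + (L.m + 4) * (X \ C).card := by
      rw [hsum, Nat.mul_add]
    have hmulD : L.m + 4 ≤ (L.m + 4) * (X \ C).card :=
      Nat.le_mul_of_pos_right _ (Finset.card_pos.2 hDne)
    have htimes : 2 * X.card * (T + 1) =
        2 * C.card * (T + 1) + 2 * (X \ C).card * (T + 1) := by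
      rw [hsum]
      ring
    have hpC : 0 < C.card * (T + 1) := Nat.mul_pos hCpos (Nat.succ_pos _)
    have hrC : restrict (restrict B.toFinset X) C = restrict B.toFinset C :=
      restrict_restrict hC.subset
    have hrD : restrict (restrict B.toFinset X) (X \ C) = restrict B.toFinset (X \ C) :=
      restrict_restrict Finset.sdiff_subset
    have hwlen : (w ++ 1 :: idx.length :: idx.map Fin.val).length = w.length + 2 + idx.length := by
      simp
      omega
    -- As `X \ C` is nonempty, it frees one block number and at least `L.m + 4` words, enough for
    -- the number `k + 1` and for the words of the node.
    rcases ih _ hClt C (k + 1) _ b rfl hCne hb (by omega) (by omega) with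
      ⟨c, tc, hec, htc, hbc, hF⟩ |
      ⟨c, tc, l, wl, hbc, hel, hwl, htc, hsc, h12c, h1c, hwrc, hcolc, hec⟩
    · refine .inl ⟨c, t + tc + 1, .loopStep ha12 hex hec, ?_,
        .failLeft X _ C hX2 hC hcard (by rwa [hrC]), hF⟩
      have : T + 1 ≤ (X \ C).card * (T + 1) :=
        Nat.le_mul_of_pos_left _ (Finset.card_pos.2 hDne)
      have : 2 * (X \ C).card * (T + 1) = (X \ C).card * (T + 1) + (X \ C).card * (T + 1) := by ring
      omega
    · have hcolc' : ∀ u : Fin L.n,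
          c.arr .col u = if u ∈ C then L.n else a.arr .col u := by
        intro u
        rw [hcolc, hcol]
        split_ifs <;> rfl
      -- The vertices of `C` are now marked by `n`, which differs from `k`, so the number `k`
      -- singles out `X \ C`.
      have hready : Ready L (X \ C) k ((w ++ 1 :: idx.length :: idx.map Fin.val) ++ wl) c := by
        refine ⟨hsc, h12c, fun u => ?_, fun u => ?_, h1c, hwrc⟩
        · rw [hcolc', Finset.mem_sdiff, ha.mem_block]
          split_ifs with hu
          · simp only [hu, not_true_eq_false, and_false, false_iff]
            omega
          · simp [hu]
        · rw [hcolc']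
          split_ifs
          · exact .inr rfl
          · exact ha.block_le u
      -- The slack `L.m + 2` in the length bound for `wl` pays for the words of the node.
      rcases ih _ (by omega) (X \ C) k _ c rfl hDne hready (by omega)
        (by rw [List.length_append]; omega) with
        ⟨d, td, hed, htd, hbd, hF⟩ |
        ⟨d, td, r, wr, hbd, her, hwr, htd, hsd', h12d, h1d, hwrd, hcold, hed⟩
      · refine .inl ⟨d, t + (tc + td) + 1, .loopStep ha12 hex (hec _ _ hed), ?_,
          .failRight X _ C l hX2 hC hcard (by rwa [hrC]) (by rwa [hrD]), hF⟩
        omega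
      · have hw : w ++ 1 :: idx.length :: idx.map Fin.val ++ wl ++ wr =
            w ++ (1 :: idx.length :: (idx.map Fin.val ++ wl ++ wr)) := by simp
        rw [hw] at h1d hwrd
        refine .inr ⟨d, t + tc + td + 1, _, 1 :: idx.length :: (idx.map Fin.val ++ wl ++ wr),
          .node X _ C l r hX2 hC hcard (by rwa [hrC])
          (by rwa [hrD]), ?_, ?_, ?_, hsd', h12d, h1d, hwrd, ?_, ?_⟩
        · rw [hrC, hrD, ← hidx]
          exact encodesTree_node hnd hel her
        · simp only [List.length_cons, List.length_append, List.length_map]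
          omega
        · omega
        · intro u
          simp only [hcold, hcolc', Finset.mem_sdiff]
          by_cases hu : u ∈ C
          · simp [hu, hC.subset hu]
          · simp [hu]
        · intro s' t' h
          have := Exec.loopStep ha12 hex (hec _ _ (hed _ _ h))
          rwa [show t + tc + td + 1 + t' = t + (tc + (td + t')) + 1 by omega]

theorem output_conc {b : AState} {w : List ℕ} (h0 : b.reg 0 = L.base .out)
    (h1 : b.reg 1 = w.length) (hw : WrittenAt (b.arr .out) 0 w) (hcap : w.length ≤ L.cap) :
    (L.conc b).output = w := by
  refine List.ext_getElem (by simp [State.output, Lay.conc, h1]) fun i h2 h3 => ?_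
  simp only [State.output, List.getElem_map, List.getElem_range]
  have : (L.conc b).reg 0 = L.base .out := h0
  rw [this, Lay.conc_mem_arr _ (by change i < L.cap; omega), ← hw i h3, zero_add]

/-- Compute the addresses of the arrays and write the first word of the output. -/
def setup : Prog :=
  .const 4 1 ;; .const 11 2 ;; .load 2 10 ;; .load 3 4 ;; .op .add 5 2 4 ;; .op .mul 6 3 5 ;;
    .op .add 6 6 11 ;; .op .add 7 6 2 ;; .op .add 8 7 2 ;; .op .add 9 8 2 ;; .op .add 0 9 3 ;;
    .op .lt 12 10 2 ;; .op .add 13 12 4 ;; wr .out 1 13 ;; .op .add 1 4 10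

/-- All registers and arrays are zero. -/
def AState.zero : AState := ⟨fun _ => 0, fun _ _ => 0⟩

/-- The truth value of `0 < n` is the initial number of blocks and, increased by 1, the first output
word: `1` for the empty tree, `2` for a nonempty one. The memory behind the input is zero, so all
vertices start in block `0`. -/
theorem Tr.setup {Q : AState → Prop} (h0 : L.inp 0 = L.n) (h1 : L.inp 1 = L.m)
    (hQ : ∀ b, Std L b → b.reg 12 = (if 0 < L.n then 1 else 0) → b.reg 1 = 1 →
      b.arr .out 0 = (if 0 < L.n then 1 else 0) + 1 → (∀ u, b.arr .col u = 0) → Q b) :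
    Tr L HDecomp.setup 16 .zero Q := by
  obtain ⟨hdw, hd2, h2w⟩ := L.data_lt_word
  have hb := L.base_lt_word
  have hd : L.m * (L.n + 1) + 2 = L.data := by simp only [Lay.data]; omega
  have hc := hb .col
  have hp := hb .cmp
  have hm := hb .mk
  have hf := hb .flg
  have ho := hb .out
  simp only [Lay.base] at hc hp hm hf ho
  refine .const_seq (by omega) (.const_seq (by omega) ?_)
  refine .load_inp_seq (i := 0) (by simp [AState.zero]) (by omega) ?_
  refine .load_inp_seq (i := 1) (by simp) (by omega) ?_
  rw [h0, h1]
  refine .op_seq (z := L.n + 1) (by simp [BinOp.eval]) (by omega) ?_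
  refine .op_seq (z := L.m * (L.n + 1)) (by simp [BinOp.eval]) (by omega) ?_
  refine .op_seq (z := L.data) (by simp [BinOp.eval, hd]) (by omega) ?_
  refine .op_seq (z := L.data + L.n) (by simp [BinOp.eval]) (by omega) ?_
  refine .op_seq (z := L.data + 2 * L.n) (by simp [BinOp.eval]; omega) (by omega) ?_
  refine .op_seq (z := L.data + 3 * L.n) (by simp [BinOp.eval]; omega) (by omega) ?_
  refine .op_seq (z := L.data + 3 * L.n + L.m) (by simp [BinOp.eval]) (by omega) ?_
  refine .op_seq (z := if 0 < L.n then 1 else 0) (by simp [BinOp.eval, AState.zero])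
    (by split_ifs <;> omega) ?_
  refine .op_seq (z := (if 0 < L.n then 1 else 0) + 1) (by simp [BinOp.eval])
    (by split_ifs <;> omega) ?_
  refine .wr_seq (i := 0) ?_ (by simp [AState.zero]) L.one_le_cap (by omega) ?_
  · constructor
    · intro A
      cases A <;> simp [breg, Lay.base]
    all_goals simp [AState.zero]
  refine .op (z := 1) (by simp [BinOp.eval, AState.zero]) (by omega) ?_
  refine hQ _ ?_ (by simp) (by simp) (by simp [AState.setArr_arr]) ?_
  · constructor
    · intro A
      cases A <;> simp [breg, Lay.base]
    all_goals simp [AState.zero]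
  · intro u
    simp [AState.setArr_arr, AState.zero]

end Main

/-! ## The input -/

theorem getD_flatMap {α : Type*} (f : α → List ℕ) {c : ℕ} :
    ∀ (l : List α) (_ : ∀ x ∈ l, (f x).length = c) (i j : ℕ) (hi : i < l.length) (_ : j < c),
      (l.flatMap f).getD (i * c + j) 0 = (f l[i]).getD j 0
  | [], _, i, _, hi, _ => by simp at hi
  | x :: l, hf, i, j, hi, hj => by
    have hx := hf x (by simp)
    rw [List.flatMap_cons]
    cases i with
    | zero =>
      rw [List.getD_append _ _ _ _ (by omega)]
      simp
    | succ i =>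
      rw [List.getD_append_right _ _ _ _ (by rw [hx, Nat.succ_mul]; omega), hx,
        show (i + 1) * c + j - c = i * c + j by rw [Nat.succ_mul]; omega,
        getD_flatMap f l (fun y hy => hf y (by simp [hy])) i j (by simpa using hi) hj]
      simp

section Input

variable {n : ℕ} (B : List (Implication (Fin n)))

theorem length_encodeBase : (encodeBase B).length = 2 + B.length * (n + 1) := by
  simp only [encodeBase, List.length_cons, List.length_flatMap, List.length_ofFn]
  simp
  omega

theorem encodeBase_getD {i j : ℕ} (hi : i < B.length) (hj : j < n + 1) :
    (encodeBase B).getD (i * (n + 1) + 2 + j) 0 =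
      ((B[i].2 : ℕ) :: List.ofFn fun v : Fin n => if v ∈ B[i].1 then 1 else 0).getD j 0 := by
  rw [show i * (n + 1) + 2 + j = (i * (n + 1) + j) + 1 + 1 by omega, encodeBase,
    List.getD_cons_succ, List.getD_cons_succ]
  exact getD_flatMap (fun p : Implication (Fin n) => (p.2 : ℕ) :: List.ofFn fun v : Fin n =>
    if v ∈ p.1 then 1 else 0) B (by simp) i j hi hj

theorem encodeBase_getD_concl {i : ℕ} (hi : i < B.length) :
    (encodeBase B).getD (i * (n + 1) + 2) 0 = B[i].2 := by
  simpa using encodeBase_getD B hi (Nat.succ_pos n)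

theorem encodeBase_getD_prem {i : ℕ} (hi : i < B.length) (v : Fin n) :
    (encodeBase B).getD (i * (n + 1) + 2 + 1 + v) 0 = if v ∈ B[i].1 then 1 else 0 := by
  rw [show i * (n + 1) + 2 + 1 + (v : ℕ) = i * (n + 1) + 2 + (v + 1) by omega,
    encodeBase_getD B hi (by omega), List.getD_cons_succ, List.getD_eq_getElem _ _ (by simp)]
  simp

/-- The layout for the input `B`. -/
def layout (space word : ℕ) (hsp : 2 + B.length * (n + 1) + 3 * n + B.length +
    (1 + (B.length + 4) * n) ≤ space) (hw : space < word) : Lay where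
  n := n
  m := B.length
  cap := 1 + (B.length + 4) * n
  space := space
  word := word
  inp x := (encodeBase B).getD x 0
  conclusion_lt i hi := by
    rw [encodeBase_getD_concl B hi]
    exact B[i].2.2
  one_le_cap := by omega
  space_eq := hsp
  space_le := hw

variable {B} {space word : ℕ} {hsp : 2 + B.length * (n + 1) + 3 * n + B.length +
  (1 + (B.length + 4) * n) ≤ space} {hw : space < word}

theorem represents_layout : Represents (layout B space word hsp hw) B where
  length := rfl
  concl i hi := encodeBase_getD_concl B hi
  prem i hi v := by
    refine (not_congr (Eq.congr_left (encodeBase_getD_prem B hi v))).trans ?_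
    simp
    rfl

theorem conc_zero : (layout B space word hsp hw).conc .zero = State.init (encodeBase B) := by
  simp only [Lay.conc, State.init, AState.zero, State.mk.injEq, true_and]
  funext x
  split_ifs with h
  · rfl
  -- Behind the input the initial memory holds the default value `0`, in agreement with the zero
  -- arrays.
  all_goals
    rw [List.getD_eq_default]
    rw [length_encodeBase]
    exact not_lt.1 h

end Input

/-! ## The complete program -/

def buildTreeProgram : Prog := setup ;; mainLoop

/-- Since `i ≤ ack i x`, the set is nonempty and its infimum is attained; the infimum of an empty
set would be `0`. -/
theorem one_le_invAckermann (m n : ℕ) : 1 ≤ invAckermann m n := by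
  refine (Nat.sInf_mem (s := {i | 1 ≤ i ∧ Nat.log 2 n < ack i (m / n)}) ?_).1
  refine ⟨Nat.log 2 n + 1, by omega, ?_⟩
  exact lt_of_lt_of_le (Nat.lt_succ_self _)
    ((ack_strictMono_left (m / n)).le_apply)

/-- Every address fits into a word: multiply `M < 2 ^ (log M + 1)` by `c ≤ 2 ^ (c - 1)`, and bound
the exponent `c - 1` by `(c - 1) * (log M + 1)`. -/
theorem space_lt_word (c M : ℕ) (hc : 1 ≤ c) : c * M < 2 ^ (c * (Nat.log 2 M + 1)) := by
  have h1 : M < 2 ^ (Nat.log 2 M + 1) := Nat.lt_pow_succ_log_self (by omega) M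
  have h2 : c ≤ 2 ^ (c - 1) := by
    have := Nat.lt_two_pow_self (n := c - 1)
    omega
  have h3 : c * (Nat.log 2 M + 1) = (c - 1) * (Nat.log 2 M + 1) + (Nat.log 2 M + 1) := by
    rw [← Nat.succ_mul]
    congr
    omega
  have h4 : c - 1 ≤ (c - 1) * (Nat.log 2 M + 1) := Nat.le_mul_of_pos_right _ (by omega)
  rw [h3, pow_add]
  exact Nat.mul_lt_mul_of_le_of_lt (h2.trans (Nat.pow_le_pow_right (by omega) h4)) h1
    (by positivity)

/-- The loop starts with the single block `univ` and the output `[2]`, or with no block if `n = 0`.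
In the time bound, `41` is the `40` of `Lay.stepTime` plus the loop test, and `17` is the setup plus
the last test. -/
theorem exists_exec {n : ℕ} (B : List (Implication (Fin n)))
    (hB : IsBase Finset.univ B.toFinset) {space word : ℕ}
    (hsp : 2 + B.length * (n + 1) + 3 * n + B.length + (1 + (B.length + 4) * n) ≤ space)
    (hw : space < word) :
    ∃ (s : State) (t : ℕ) (o : Outcome (Fin n)),
      Exec space word buildTreeProgram (State.init (encodeBase B)) s t ∧
      t ≤ 2 * n * (B.length * (n * 55 + 59) + n * 27 + 41) + 17 ∧
      BuildTree Finset.univ B.toFinset o ∧ EncodesOutcome B o s.output := by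
  set L := layout B space word hsp hw with hL
  have hrep : Represents L B := represents_layout
  obtain ⟨a, t, hex, ht, hstd, h12, h1, hout, hcol⟩ := Tr.setup (L := L)
    (Q := fun b => Std L b ∧ b.reg 12 = (if 0 < L.n then 1 else 0) ∧ b.reg 1 = 1 ∧
      b.arr .out 0 = (if 0 < L.n then 1 else 0) + 1 ∧ ∀ u, b.arr .col u = 0) rfl rfl
    fun b h1 h2 h3 h4 h5 => ⟨h1, h2, h3, h4, h5⟩
  rw [hL, conc_zero, ← hL] at hex
  rcases Nat.eq_zero_or_pos n with rfl | hn
  · refine ⟨L.conc a, t + 1, .ok none, .seq hex (.loopDone ?_), by omega, .empty _, ?_⟩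
    · exact h12
    · rw [output_conc (w := [1]) (hstd.base .out) h1 ?_ L.one_le_cap]
      · exact .empty
      · exact writtenAt_cons.2 ⟨hout, writtenAt_nil⟩
  · have hn' : 0 < L.n := hn
    rw [if_pos hn'] at h12 hout
    have hcard : (Finset.univ : Finset (Fin L.n)).card = n := by
      rw [Finset.card_univ, Fintype.card_fin]
      rfl
    have hself : restrict B.toFinset Finset.univ = B.toFinset := hB.restrict_self
    have hT : L.stepTime + 1 = B.length * (n * 55 + 59) + n * 27 + 41 := rfl
    have hready : Ready L (Finset.univ : Finset (Fin L.n)) 0 [2] a :=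
      ⟨hstd, h12, by simp [hcol], by simp [hcol], h1, writtenAt_cons.2 ⟨hout, writtenAt_nil⟩⟩
    rcases exec_block hrep _ (Finset.univ : Finset (Fin L.n)) 0 [2] a rfl
      (Finset.card_pos.1 (by omega)) hready (by rw [hcard, zero_add]; exact le_rfl)
      (by rw [hcard]; exact le_rfl) with
      ⟨b, t', hex', ht', hbt, hF⟩ |
      ⟨b, t', T, wT, hbt, henc, hwT, ht', hsb, h12b, h1b, hwr, -, hcont⟩
    · rw [hcard, hT] at ht'
      refine ⟨L.conc b, t + t', .fail, .seq hex hex', by omega, ?_, ?_⟩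
      · rw [← hself]
        exact hbt
      · rw [output_conc (w := [0]) hF.address hF.length ?_ L.one_le_cap]
        · exact .fail
        · exact writtenAt_cons.2 ⟨hF.word, writtenAt_nil⟩
    · rw [hcard, hT] at ht'
      rw [hcard] at hwT
      refine ⟨L.conc b, t + (t' + 1), .ok (some T), .seq hex (hcont _ _ (.loopDone h12b)),
        by omega, ?_, ?_⟩
      · rw [← hself]
        exact hbt
      · rw [output_conc (hsb.base .out) h1b hwr ?_]
        · exact .tree henc
        · change _ ≤ 1 + (B.length + 4) * n
          have : L.m = B.length := rfl
          rw [this] at hwT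
          simp only [List.length_append, List.length_cons, List.length_nil]
          omega

/-- With `M = m' * n'` the left side is at most `14 * M`; the constant `400` comes from the running
time. -/
theorem space_bound {m n m' n' c : ℕ} (hm : m ≤ m') (hn : n ≤ n') (hm1 : 1 ≤ m') (hn1 : 1 ≤ n')
    (hc : 400 ≤ c) :
    2 + m * (n + 1) + 3 * n + m + (1 + (m + 4) * n) ≤ c * (m' * n') := by
  have hmn : m * n ≤ m' * n' := Nat.mul_le_mul hm hn
  have h1 : m' ≤ m' * n' := Nat.le_mul_of_pos_right _ hn1
  have h2 : n' ≤ m' * n' := Nat.le_mul_of_pos_left _ hm1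
  have e1 : m * (n + 1) = m * n + m := by ring
  have e2 : (m + 4) * n = m * n + 4 * n := by ring
  have e3 := Nat.mul_le_mul_right (m' * n') hc
  omega

/-- Here `182 = 55 + 59 + 27 + 41`, and `400 = 2 * 182 + 36`, where `36` generously absorbs the
summand `17`. -/
theorem time_bound {m n m' n' c α : ℕ} (hm : m ≤ m') (hn : n ≤ n') (hm1 : 1 ≤ m') (hn1 : 1 ≤ n')
    (hc : 400 ≤ c) (hα : 1 ≤ α) :
    2 * n * (m * (n * 55 + 59) + n * 27 + 41) + 17 ≤ c * (n' ^ 2 * m' * α) := by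
  have h1 : m * (n * 55 + 59) + n * 27 + 41 ≤ m' * n' * 182 := by
    have hmn : m * n ≤ m' * n' := Nat.mul_le_mul hm hn
    have h1 : m' ≤ m' * n' := Nat.le_mul_of_pos_right _ hn1
    have h2 : n' ≤ m' * n' := Nat.le_mul_of_pos_left _ hm1
    have e1 : m * (n * 55 + 59) = m * n * 55 + m * 59 := by ring
    omega
  have h2 : 1 ≤ n' ^ 2 * m' := Nat.mul_pos (Nat.pow_pos hn1) hm1
  calc 2 * n * (m * (n * 55 + 59) + n * 27 + 41) + 17
      ≤ 2 * n' * (m' * n' * 182) + 36 * (n' ^ 2 * m') := by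
        gcongr
        omega
    _ = 400 * (n' ^ 2 * m' * 1) := by ring
    _ ≤ c * (n' ^ 2 * m' * α) := by gcongr

theorem buildTreeProgram_spec {n : ℕ} (B : List (Implication (Fin n)))
    (hB : IsBase Finset.univ B.toFinset) {c : ℕ} (hc : 400 ≤ c) :
    ∃ (s : State) (t : ℕ) (o : Outcome (Fin n)),
      Exec (c * (max 1 B.length * max 1 n))
        (2 ^ (c * (Nat.log 2 (max 1 B.length * max 1 n) + 1)))
        buildTreeProgram (State.init (encodeBase B)) s t ∧
      t ≤ c * (max 1 n ^ 2 * max 1 B.length *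
        invAckermann (max 1 B.length * max 1 n) (max 1 n)) ∧
      BuildTree Finset.univ B.toFinset o ∧ EncodesOutcome B o s.output := by
  have hm : B.length ≤ max 1 B.length := le_max_right _ _
  have hm1 : 1 ≤ max 1 B.length := le_max_left _ _
  have hn : n ≤ max 1 n := le_max_right _ _
  have hn1 : 1 ≤ max 1 n := le_max_left _ _
  obtain ⟨s, t, o, hex, ht, hbt, henc⟩ := exists_exec B hB (space_bound hm hn hm1 hn1 hc)
    (space_lt_word c _ (le_trans (by norm_num) hc))
  exact ⟨s, t, o, hex, ht.trans (time_bound hm hn hm1 hn1 hc (one_le_invAckermann _ _)), hbt, henc⟩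

end HDecomp

open HDecomp in
theorem mainTheorem4 :
    -- correctness: `BuildTree` always has an outcome, and every possible outcome is a tree of
    -- the base if there is one and `FAIL` otherwise
    (∀ (V : Type*) [DecidableEq V] (U : Finset V) (S : Finset (Implication V)),
      IsBase U S → (∀ a, (({a}, a) : Implication V) ∉ S) →
        (∃ o, BuildTree U S o) ∧
        ∀ o, BuildTree U S o →
          (∃ T, o = .ok T ∧ IsSigmaTree U S T) ∨ (o = .fail ∧ ¬ HDecomposable U S)) ∧
    -- complexity: a fixed word RAM program implements `BuildTree` within the stated bounds
    (∃ (P : Prog) (c : ℕ), ∀ (n : ℕ) (B : List (Implication (Fin n))),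
      B.Nodup → IsBase Finset.univ B.toFinset →
        ∃ (s : State) (t : ℕ) (o : Outcome (Fin n)),
          Exec (c * (max 1 B.length * max 1 n))
            (2 ^ (c * (Nat.log 2 (max 1 B.length * max 1 n) + 1)))
            P (State.init (encodeBase B)) s t ∧
          t ≤ c * (max 1 n ^ 2 * max 1 B.length *
            invAckermann (max 1 B.length * max 1 n) (max 1 n)) ∧
          BuildTree Finset.univ B.toFinset o ∧
          EncodesOutcome B o s.output) := by
  refine ⟨fun V _ U S hS hloop => buildTree_correct hS hloop, buildTreeProgram, 400, ?_⟩
  exact fun n B _ hB => buildTreeProgram_spec B hB le_rfl
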